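/- **Theorem 5.2.** Let $t$ be a positive even integer, let $R$ be a commutative ring (for example $\mathbb C$, or a ring of Laurent polynomials), and let $\tilde\rho_1,\tilde\rho_2:\mathbb Z\times\{-1,1\}\to R$ be arbitrary functions. Let $x\in R$ and let $b\in R$ be invertible ($x$ and $b$ may be indeterminates). Let $\mathcal P$ be the set of all integer partitions (including the empty one), identified with their Ferrers diagrams, and let $\mathcal{SC}\subset\mathcal P$ be the set of self-conjugate partitions. For a box $u$ of $\lambda\in\mathcal P$ let $h_u$ be its hook-length, that is, the number of boxes that are equal to $u$, or strictly to the right of $u$ in the same row, or strictly below $u$ in the same column. Let $\mathcal H(\lambda)$ be the multiset of all hook-lengths of $\lambda$, and $\mathcal H_t(\lambda)$ the multiset of those that are divisible by $t$. Put $\varepsilon_u=-1$ if $u$ is strictly below the main diagonal and $\varepsilon_u=1$ otherwise. Let $\mathrm{BG}(\lambda)=\sum_{(i,j)\in\lambda}(-1)^{i+j}$ be the BG-rank of $\lambda$. For formal power series $a,p$ in $q$, with $p$ having zero constant term, write $(a;p)_\infty=\prod_{j\ge0}(1-ap^j)$. Define the formal power series $$f_t(q)=\sum_{\nu\in\mathcal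 P}q^{|\nu|}\prod_{h\in\mathcal H(\nu)}\tilde\rho_1(th,1)\,\tilde\rho_1(th,-1),$$ $$g_t(q)=\sum_{\nu\in\mathcal P}q^{|\nu|}\prod_{h\in\mathcal H(\nu)}\tilde\rho_1(th,1)\,\tilde\rho_1(th,-1)\sum_{h\in\mathcal H(\nu)}\bigl(\tilde\rho_2(th,1)+\tilde\rho_2(th,-1)\bigr).$$ Then, as formal power series in $q$ with coefficients in $R$, $$\sum_{\lambda\in\mathcal{SC}}q^{|\lambda|}x^{|\mathcal H_t(\lambda)|}b^{\mathrm{BG}(\lambda)}\prod_{\substack{u\in\lambda\\ h_u\in\mathcal H_t(\lambda)}}\tilde\rho_1(h_u,\varepsilon_u)\sum_{\substack{u\in\lambda\\ h_u\in\mathcal H_t(\lambda)}}\tilde\rho_2(h_u,\varepsilon_u)$$ $$=\frac t2\,\bigl(f_t(x^2q^{2t})\bigr)^{t/2-1}\,g_t(x^2q^{2t})\,(q^{2t};q^{2t})_\infty^{t/2}\,(-bq;q^4)_\infty\,(-q^3/b;q^4)_\infty.$$ -/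

import Mathlib

open PowerSeries

namespace SelfConjHook

/-- There are only finitely many Young diagrams (integer partitions) with `n` boxes. -/
theorem finite_card_eq (n : ℕ) : {μ : YoungDiagram | μ.card = n}.Finite := by
  refine Set.Finite.of_finite_image (f := fun μ : YoungDiagram => μ.cells)
    (Set.Finite.subset (Finset.finite_toSet
      ((Finset.range n ×ˢ Finset.range n).powerset)) ?_)
    (fun μ _ ν _ h => YoungDiagram.ext h)
  rintro _ ⟨μ, hμ, rfl⟩
  simp only [Finset.coe_powerset, Set.mem_preimage, Set.mem_powerset_iff, Finset.coe_subset]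
  rintro ⟨i, j⟩ hc
  have hμ' : μ.cells.card = n := hμ
  have hr : (μ.row i).card ≤ n := hμ' ▸ Finset.card_le_card (Finset.filter_subset _ _)
  have hl : (μ.col j).card ≤ n := hμ' ▸ Finset.card_le_card (Finset.filter_subset _ _)
  rw [← YoungDiagram.rowLen_eq_card] at hr
  rw [← YoungDiagram.colLen_eq_card] at hl
  have h1 := YoungDiagram.mem_iff_lt_rowLen.1 ((YoungDiagram.mem_cells _).1 hc)
  have h2 := YoungDiagram.mem_iff_lt_colLen.1 ((YoungDiagram.mem_cells _).1 hc)
  simp only [Finset.mem_product, Finset.mem_range]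
  omega

/-- The finite set of all integer partitions of `n`, as Young diagrams. The box in row `i` and
column `j` (both counted from `0`, rows downwards) is the cell `(i, j)`. -/
noncomputable def partitionsOf (n : ℕ) : Finset YoungDiagram :=
  (finite_card_eq n).toFinset

theorem mem_partitionsOf {n : ℕ} {μ : YoungDiagram} : μ ∈ partitionsOf n ↔ μ.card = n := by
  simp [partitionsOf]

/-- The set `𝒮𝒞` of self-conjugate partitions. -/
def SC : Set YoungDiagram := {μ | μ.transpose = μ}

/-- The hook-length of the box `v` in `μ`: the number of boxes `u` of `μ` such that `u = v`, or `u`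
is strictly to the right of `v` in its row, or `u` is strictly below `v` in its column. -/
def hookLength (μ : YoungDiagram) (v : ℕ × ℕ) : ℕ :=
  (μ.cells.filter fun u =>
    u = v ∨ (u.1 = v.1 ∧ v.2 < u.2) ∨ (u.2 = v.2 ∧ v.1 < u.1)).card

/-- The boxes of `μ` whose hook-length is a multiple of `t`. The multiset of their hook-lengths
is `ℋ_t(μ)`. -/
def boxes (t : ℕ) (μ : YoungDiagram) : Finset (ℕ × ℕ) :=
  μ.cells.filter fun u => t ∣ hookLength μ u

/-- The sign `ε_u` of a box: `-1` strictly below the main diagonal and `1` otherwise. -/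
def boxSign (u : ℕ × ℕ) : ℤˣ := if u.2 < u.1 then -1 else 1

/-- The BG-rank: the sum over the boxes of alternating signs, with `+1` in the top left box. -/
def bgRank (μ : YoungDiagram) : ℤ := ∑ u ∈ μ.cells, (-1) ^ (u.1 + u.2)

section Series

variable {R : Type*} [CommRing R]

open Classical in
/-- The formal power series `∑_{μ ∈ S} w(μ) q^{|μ|}` in the variable `q = X`. -/
noncomputable def partitionSeries (S : Set YoungDiagram) (w : YoungDiagram → R) : R⟦X⟧ :=
  PowerSeries.mk fun n => ∑ μ ∈ partitionsOf n with μ ∈ S, w μ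

/-- The infinite `q`-Pochhammer symbol `(a; p)_∞ = ∏_{j ≥ 0} (1 - a p^j)` of formal power series
`a` and `p`, where the product converges coefficientwise (every coefficient is eventually
constant): this is convergence in the product topology for the discrete topology on `R`. -/
noncomputable def qPoch (a p : R⟦X⟧) : R⟦X⟧ :=
  letI : TopologicalSpace R := ⊥
  letI : TopologicalSpace R⟦X⟧ := PowerSeries.WithPiTopology.instTopologicalSpace R
  ∏' j : ℕ, (1 - a * p ^ j)

/-- The infinite product in `qPoch` converges as soon as `p` has no constant term. -/
theorem multipliable_qPoch (a p : R⟦X⟧) (hp : constantCoeff p = 0) :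
    letI : TopologicalSpace R := ⊥
    letI : TopologicalSpace R⟦X⟧ := PowerSeries.WithPiTopology.instTopologicalSpace R
    Multipliable fun j : ℕ => 1 - a * p ^ j := by
  letI : TopologicalSpace R := ⊥
  simp_rw [sub_eq_add_neg]
  apply WithPiTopology.multipliable_one_add_of_tendsto_order_atTop_nhds_top
  refine ENat.tendsto_nhds_top_iff_natCast_lt.mpr fun n =>
    Filter.eventually_atTop.mpr ⟨n + 1, fun j hj => ?_⟩
  have h1 : (1 : ℕ∞) ≤ p.order := by
    rw [Order.one_le_iff_ne_zero, PowerSeries.order_ne_zero_iff_constCoeff_eq_zero]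
    exact hp
  have h2 : (j : ℕ∞) ≤ (p ^ j).order := by
    refine le_trans ?_ (PowerSeries.le_order_pow p j)
    simpa using nsmul_le_nsmul_right h1 j
  rw [PowerSeries.order_neg]
  calc (n : ℕ∞) < j := by exact_mod_cast hj
    _ ≤ (p ^ j).order := h2
    _ ≤ a.order + (p ^ j).order := le_add_self
    _ ≤ (a * p ^ j).order := PowerSeries.le_order_mul _ _

/-- `f_t(q) = ∑_ν q^{|ν|} ∏_{h ∈ ℋ(ν)} ρ₁(th, 1) ρ₁(th, -1)`, the sum being over all partitions. -/
noncomputable def fSeries (t : ℕ) (ρ₁ : ℤ × ℤˣ → R) : R⟦X⟧ :=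
  partitionSeries Set.univ fun ν =>
    ∏ u ∈ ν.cells, ρ₁ (t * hookLength ν u, 1) * ρ₁ (t * hookLength ν u, -1)

/-- `g_t(q) = ∑_ν q^{|ν|} ∏_{h ∈ ℋ(ν)} ρ₁(th, 1) ρ₁(th, -1) ∑_{h ∈ ℋ(ν)} (ρ₂(th, 1) + ρ₂(th, -1))`,
the sum being over all partitions. -/
noncomputable def gSeries (t : ℕ) (ρ₁ ρ₂ : ℤ × ℤˣ → R) : R⟦X⟧ :=
  partitionSeries Set.univ fun ν =>
    (∏ u ∈ ν.cells, ρ₁ (t * hookLength ν u, 1) * ρ₁ (t * hookLength ν u, -1)) *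
      ∑ u ∈ ν.cells, (ρ₂ (t * hookLength ν u, 1) + ρ₂ (t * hookLength ν u, -1))

end Series

end SelfConjHook

open SelfConjHook

open scoped PowerSeries.WithPiTopology

namespace SelfConjHook

section Beads

/-- The position of the vertical step of the boundary of `μ` that ends row `i`. -/
def rowBead (μ : YoungDiagram) (i : ℕ) : ℤ := μ.rowLen i - i - 1

/-- The position of the horizontal step of the boundary of `μ` that ends column `j`. -/
def colBead (μ : YoungDiagram) (j : ℕ) : ℤ := j - μ.colLen j

/-- The Maya diagram of `μ` with charge `n`. -/
def beads (μ : YoungDiagram) (n : ℤ) : Set ℤ := {k | ∃ i, rowBead μ i + n = k}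

theorem rowBead_strictAnti (μ : YoungDiagram) : StrictAnti (rowBead μ) := by
  intro i j h
  have := μ.rowLen_anti i j h.le
  unfold rowBead
  omega

theorem colBead_strictMono (μ : YoungDiagram) : StrictMono (colBead μ) := by
  intro i j h
  have := μ.colLen_anti i j h.le
  unfold colBead
  omega

theorem colBead_lt_rowBead_iff {μ : YoungDiagram} {i j : ℕ} :
    colBead μ j < rowBead μ i ↔ (i, j) ∈ μ := by
  have h1 := YoungDiagram.mem_iff_lt_rowLen (μ := μ) (i := i) (j := j)
  have h2 := YoungDiagram.mem_iff_lt_colLen (μ := μ) (i := i) (j := j)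
  unfold rowBead colBead
  constructor
  · intro h
    by_contra hc
    have := mt h1.2 hc
    have := mt h2.2 hc
    omega
  · intro h
    have := h1.1 h
    have := h2.1 h
    omega

theorem colBead_ne_rowBead (μ : YoungDiagram) (i j : ℕ) : colBead μ j ≠ rowBead μ i := by
  have h1 := YoungDiagram.mem_iff_lt_rowLen (μ := μ) (i := i) (j := j)
  have h2 := YoungDiagram.mem_iff_lt_colLen (μ := μ) (i := i) (j := j)
  unfold rowBead colBead
  by_cases h : (i, j) ∈ μ
  · have := h1.1 h
    have := h2.1 h
    omega
  · have := mt h1.2 h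
    have := mt h2.2 h
    omega

theorem exists_rowBead_le (μ : YoungDiagram) (k : ℤ) : ∃ i, rowBead μ i ≤ k := by
  refine ⟨(μ.rowLen 0 - k).toNat, ?_⟩
  have := μ.rowLen_anti 0 (μ.rowLen 0 - k).toNat (Nat.zero_le _)
  unfold rowBead
  omega

theorem exists_colBead_eq {μ : YoungDiagram} {k : ℤ} (h : ∀ i, rowBead μ i ≠ k) :
    ∃ j, colBead μ j = k := by
  classical
  have hex := exists_rowBead_le μ k
  obtain ⟨i, hi, hmin⟩ : ∃ i, rowBead μ i ≤ k ∧ ∀ i' < i, k < rowBead μ i' :=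
    ⟨Nat.find hex, Nat.find_spec hex, fun i' h' => not_le.1 (Nat.find_min hex h')⟩
  have hlt := lt_of_le_of_ne hi (h i)
  have hj : (0 : ℤ) ≤ k + i := by
    unfold rowBead at hlt
    omega
  refine ⟨(k + i).toNat, ?_⟩
  have h1 : ¬ i < μ.colLen (k + i).toNat := by
    rw [← YoungDiagram.mem_iff_lt_colLen, YoungDiagram.mem_iff_lt_rowLen]
    unfold rowBead at hlt
    omega
  have h2 : ¬ μ.colLen (k + i).toNat < i := by
    intro hc
    have h5 := hmin (i - 1) (by omega)
    have h6 : ¬ i - 1 < μ.colLen (k + i).toNat := by omega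
    rw [← YoungDiagram.mem_iff_lt_colLen, YoungDiagram.mem_iff_lt_rowLen] at h6
    unfold rowBead at h5
    omega
  unfold colBead
  omega

theorem notMem_beads_iff {μ : YoungDiagram} {n k : ℤ} :
    k ∉ beads μ n ↔ ∃ j, colBead μ j + n = k := by
  constructor
  · intro h
    obtain ⟨j, hj⟩ := exists_colBead_eq (μ := μ) (k := k - n)
      (fun i hi => h ⟨i, by omega⟩)
    exact ⟨j, by omega⟩
  · rintro ⟨j, hj⟩ ⟨i, hi⟩
    exact colBead_ne_rowBead μ i j (by omega)

theorem rowBead_transpose (μ : YoungDiagram) (i : ℕ) :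
    rowBead μ.transpose i = -1 - colBead μ i := by
  unfold rowBead colBead
  rw [YoungDiagram.rowLen_transpose]
  ring

theorem mem_beads_transpose {μ : YoungDiagram} {n k : ℤ} :
    k ∈ beads μ.transpose (-n) ↔ -1 - k ∉ beads μ n := by
  rw [notMem_beads_iff]
  refine exists_congr fun i => ?_
  rw [rowBead_transpose]
  omega

theorem rowBead_of_colLen_le {μ : YoungDiagram} {i : ℕ} (h : μ.colLen 0 ≤ i) :
    rowBead μ i = -i - 1 := by
  have : ¬ 0 < μ.rowLen i := by
    rw [← YoungDiagram.mem_iff_lt_rowLen, YoungDiagram.mem_iff_lt_colLen]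
    omega
  unfold rowBead
  omega

theorem ext_rowLen {μ ν : YoungDiagram} (h : ∀ i, μ.rowLen i = ν.rowLen i) : μ = ν := by
  ext ⟨i, j⟩
  rw [YoungDiagram.mem_cells, YoungDiagram.mem_cells, YoungDiagram.mem_iff_lt_rowLen,
    YoungDiagram.mem_iff_lt_rowLen, h]

theorem beads_injective {μ ν : YoungDiagram} {n n' : ℤ} (h : beads μ n = beads ν n') :
    μ = ν ∧ n = n' := by
  have key : (fun i => -(rowBead μ i + n)) = fun i => -(rowBead ν i + n') := by
    refine (StrictMono.range_inj ?_ ?_).1 ?_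
    · intro i j hij
      have := rowBead_strictAnti μ hij
      dsimp only
      omega
    · intro i j hij
      have := rowBead_strictAnti ν hij
      dsimp only
      omega
    · ext k
      have : -k ∈ beads μ n ↔ -k ∈ beads ν n' := by rw [h]
      simp only [beads, Set.mem_ofPred_eq] at this
      simp only [Set.mem_range]
      refine Iff.trans ?_ (this.trans ?_) <;>
      · refine exists_congr fun i => ?_
        omega
  have h0 : n = n' := by
    have := congrFun key (max (μ.colLen 0) (ν.colLen 0))
    simp only [rowBead_of_colLen_le (le_max_left (μ.colLen 0) (ν.colLen 0)),
      rowBead_of_colLen_le (le_max_right (μ.colLen 0) (ν.colLen 0))] at this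
    omega
  refine ⟨ext_rowLen fun i => ?_, h0⟩
  have := congrFun key i
  simp only [rowBead] at this
  omega

theorem exists_rowLen_eq {f : ℕ → ℕ} (hf : Antitone f) {N : ℕ} (hN : f N = 0) :
    ∃ μ : YoungDiagram, ∀ i, μ.rowLen i = f i := by
  have hmem : ∀ i j, (i, j) ∈ (Finset.range N ×ˢ Finset.range (f 0)).filter (fun u => u.2 < f u.1)
      ↔ j < f i := by
    intro i j
    simp only [Finset.mem_filter, Finset.mem_product, Finset.mem_range]
    refine ⟨fun h => h.2, fun h => ⟨⟨?_, h.trans_le (hf (Nat.zero_le _))⟩, h⟩⟩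
    by_contra hc
    have := hf (not_lt.1 hc)
    omega
  let μ : YoungDiagram :=
    { cells := (Finset.range N ×ˢ Finset.range (f 0)).filter (fun u => u.2 < f u.1)
      isLowerSet := by
        rintro ⟨i, j⟩ ⟨i', j'⟩ ⟨h1, h2⟩ h
        rw [Finset.mem_coe, hmem] at h ⊢
        have := hf h1
        dsimp only at h1 h2 this
        omega }
  refine ⟨μ, fun i => eq_of_forall_lt_iff fun j => ?_⟩
  rw [← YoungDiagram.mem_iff_lt_rowLen]
  exact hmem i j

theorem exists_beads_eq {S : Set ℤ} {L U : ℤ} (hL : ∀ k < L, k ∈ S) (hU : ∀ k, U < k → k ∉ S) :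
    ∃ μ n, beads μ n = S := by
  classical
  let p : ℕ → Prop := fun m => U - m ∈ S
  have hinf : (Set.ofPred p).Infinite := by
    refine Set.infinite_of_injective_forall_mem (f := fun a : ℕ => (U - L).toNat + 1 + a) ?_ ?_
    · intro a b hab
      simpa using hab
    · intro a
      change U - _ ∈ S
      refine hL _ ?_
      push_cast
      omega
  obtain ⟨F, hF, hrange⟩ : ∃ F : ℕ → ℤ, StrictAnti F ∧ ∀ k, k ∈ S ↔ ∃ i, F i = k := by
    refine ⟨fun i => U - Nat.nth p i, ?_, ?_⟩
    · intro i j hij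
      have := Nat.nth_strictMono hinf hij
      dsimp only
      omega
    · intro k
      constructor
      · intro hk
        have hkU : k ≤ U := not_lt.1 fun h => hU k h hk
        have : (U - k).toNat ∈ Set.range (Nat.nth p) := by
          rw [Nat.range_nth_of_infinite hinf]
          change U - _ ∈ S
          convert hk using 1
          omega
        obtain ⟨i, hi⟩ := this
        exact ⟨i, by dsimp only; rw [hi]; omega⟩
      · rintro ⟨i, rfl⟩
        exact Nat.nth_mem_of_infinite hinf i
  obtain ⟨i0, hi0⟩ := (hrange (L - 1)).1 (hL _ (by omega))
  have htail : ∀ a : ℕ, F (i0 + a) = L - 1 - a := by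
    intro a
    induction a with
    | zero => simpa using hi0
    | succ a ih =>
      obtain ⟨j, hj⟩ := (hrange (L - 1 - a - 1)).1 (hL _ (by omega))
      have h1 : F (i0 + (a + 1)) < F (i0 + a) := hF (by omega)
      have h2 : i0 + a < j := hF.lt_iff_gt.1 (by omega)
      have h3 : F j ≤ F (i0 + (a + 1)) := hF.antitone (by omega)
      push_cast
      omega
  have hanti : ∀ a i, F (i + a) + a ≤ F i := by
    intro a i
    induction a with
    | zero => simp
    | succ a ih =>
      have h1 : F (i + (a + 1)) < F (i + a) := hF (by omega)
      push_cast
      omega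
  have hnn : ∀ i, 0 ≤ F i + i + 1 - (L + i0) := by
    intro i
    have h1 := htail i
    have h2 := hanti i0 i
    rw [add_comm] at h1
    omega
  obtain ⟨μ, hμ⟩ := exists_rowLen_eq (f := fun i => (F i + i + 1 - (L + i0)).toNat) (N := i0)
    (fun i j hij => by
      have := hanti (j - i) i
      rw [Nat.add_sub_cancel' hij] at this
      dsimp only
      omega)
    (by omega)
  refine ⟨μ, L + i0, ?_⟩
  ext k
  rw [hrange]
  refine exists_congr fun i => ?_
  unfold rowBead
  rw [hμ]
  have := hnn i
  omega

end Beads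

section Hooks

theorem hookLength_eq {μ : YoungDiagram} {u : ℕ × ℕ} (hu : u ∈ μ) :
    (hookLength μ u : ℤ) = rowBead μ u.1 - colBead μ u.2 := by
  obtain ⟨i, j⟩ := u
  have h1 := YoungDiagram.mem_iff_lt_rowLen.1 hu
  have h2 := YoungDiagram.mem_iff_lt_colLen.1 hu
  have key : (μ.cells.filter fun u =>
      u = (i, j) ∨ (u.1 = i ∧ j < u.2) ∨ (u.2 = j ∧ i < u.1)) =
      ((Finset.Ico j (μ.rowLen i)).map (Function.Embedding.sectR i ℕ)).disjUnion
      ((Finset.Ico (i + 1) (μ.colLen j)).map (Function.Embedding.sectL ℕ j))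
      (by
        rw [Finset.disjoint_left]
        simp only [Finset.mem_map, Finset.mem_Ico, Function.Embedding.sectR_apply,
          Function.Embedding.sectL_apply]
        rintro _ ⟨b, hb, rfl⟩ ⟨a, ha, hab⟩
        simp only [Prod.mk.injEq] at hab
        omega) := by
    ext ⟨a, b⟩
    simp only [Finset.mem_filter, Finset.mem_disjUnion, Finset.mem_map, Finset.mem_Ico,
      Function.Embedding.sectR_apply, Function.Embedding.sectL_apply, Prod.mk.injEq, YoungDiagram.mem_cells]
    constructor
    · rintro ⟨h, ⟨rfl, rfl⟩ | ⟨rfl, h3⟩ | ⟨rfl, h3⟩⟩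
      · exact Or.inl ⟨b, ⟨le_rfl, h1⟩, rfl, rfl⟩
      · exact Or.inl ⟨b, ⟨h3.le, YoungDiagram.mem_iff_lt_rowLen.1 h⟩, rfl, rfl⟩
      · exact Or.inr ⟨a, ⟨h3, YoungDiagram.mem_iff_lt_colLen.1 h⟩, rfl, rfl⟩
    · rintro (⟨b, h3, rfl, rfl⟩ | ⟨a, h3, rfl, rfl⟩)
      · refine ⟨YoungDiagram.mem_iff_lt_rowLen.2 h3.2, ?_⟩
        omega
      · refine ⟨YoungDiagram.mem_iff_lt_colLen.2 h3.2, ?_⟩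
        omega
  unfold hookLength
  dsimp only
  rw [key, Finset.card_disjUnion, Finset.card_map, Finset.card_map, Nat.card_Ico, Nat.card_Ico]
  unfold rowBead colBead
  omega

/-- The pairs consisting of a gap and a bead to its right. -/
def inversions (S : Set ℤ) : Set (ℤ × ℤ) := {p | p.1 ∉ S ∧ p.2 ∈ S ∧ p.1 < p.2}

theorem bijOn_inversions (μ : YoungDiagram) (n : ℤ) :
    Set.BijOn (fun u : ℕ × ℕ => (colBead μ u.2 + n, rowBead μ u.1 + n)) μ.cells
      (inversions (beads μ n)) := by
  refine ⟨?_, ?_, ?_⟩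
  · rintro ⟨i, j⟩ hu
    have := colBead_lt_rowBead_iff.2 ((YoungDiagram.mem_cells _).1 hu)
    refine ⟨notMem_beads_iff.2 ⟨j, rfl⟩, ⟨i, rfl⟩, ?_⟩
    dsimp only
    omega
  · rintro ⟨i, j⟩ - ⟨i', j'⟩ - h
    simp only [Prod.mk.injEq, add_left_inj] at h
    rw [(colBead_strictMono μ).injective h.1, (rowBead_strictAnti μ).injective h.2]
  · rintro ⟨a, b⟩ ⟨ha, ⟨i, hi⟩, hab⟩
    obtain ⟨j, hj⟩ := notMem_beads_iff.1 ha
    refine ⟨(i, j), ?_, ?_⟩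
    · rw [Finset.mem_coe, YoungDiagram.mem_cells, ← colBead_lt_rowBead_iff]
      dsimp only at *
      omega
    · dsimp only at *
      rw [hi, hj]

end Hooks

section Energy

variable {M : Type*} [AddCommGroup M]

theorem sum_cells_eq (μ : YoungDiagram) (F : ℕ → ℕ → M) {N : ℕ} (hN : μ.colLen 0 ≤ N) :
    ∑ u ∈ μ.cells, F u.1 u.2 = ∑ i ∈ Finset.range N, ∑ j ∈ Finset.range (μ.rowLen i), F i j := by
  rw [Finset.sum_sigma']
  refine Finset.sum_bij' (fun u _ => ⟨u.1, u.2⟩) (fun s _ => (s.1, s.2)) ?_ ?_ ?_ ?_ ?_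
  · rintro ⟨i, j⟩ h
    rw [YoungDiagram.mem_cells] at h
    have h1 := YoungDiagram.mem_iff_lt_rowLen.1 h
    have h2 := YoungDiagram.mem_iff_lt_colLen.1 h
    have h3 := μ.colLen_anti 0 j (Nat.zero_le _)
    simp only [Finset.mem_sigma, Finset.mem_range]
    omega
  · rintro ⟨i, j⟩ h
    simp only [Finset.mem_sigma, Finset.mem_range] at h
    exact (YoungDiagram.mem_cells _).2 (YoungDiagram.mem_iff_lt_rowLen.2 h.2)
  all_goals simp

/-- The sum of `G` over `D`, the negative elements being counted negatively. -/
def signedSum (G : ℤ → M) (D : Finset ℤ) : M := ∑ k ∈ D, if 0 ≤ k then G k else -G k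

/-- `D` is the set of the positions where the Maya diagram `S` differs from the vacuum. -/
def IsExcitation (D : Finset ℤ) (S : Set ℤ) : Prop := ∀ k, k ∈ S ↔ (k < 0 ↔ k ∉ D)

theorem signedSum_eq_sum_range {D : Finset ℤ} {μ : YoungDiagram} {n : ℤ}
    (hD : IsExcitation D (beads μ n)) (G : ℤ → M) {N : ℕ} (hN : μ.colLen 0 ≤ N) (hn : n ≤ N) :
    signedSum G D =
      ∑ i ∈ Finset.range N, G (rowBead μ i + n) - ∑ k ∈ Finset.Ico (n - N) 0, G k := by
  have hlow : ∀ k, k < n - N → k ∈ beads μ n := fun k hk =>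
    ⟨(n - 1 - k).toNat, by rw [rowBead_of_colLen_le (by omega)]; omega⟩
  have himage : (Finset.range N).image (fun i => rowBead μ i + n) =
      D.filter (0 ≤ ·) ∪ Finset.Ico (n - N) 0 \ D := by
    ext k
    have hk := hD k
    simp only [Finset.mem_image, Finset.mem_range, Finset.mem_union, Finset.mem_filter,
      Finset.mem_sdiff, Finset.mem_Ico]
    have : (∃ i < N, rowBead μ i + n = k) ↔ n - N ≤ k ∧ k ∈ beads μ n := by
      constructor
      · rintro ⟨i, hi, rfl⟩
        refine ⟨?_, i, rfl⟩
        unfold rowBead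
        omega
      · rintro ⟨h, i, rfl⟩
        refine ⟨i, ?_, rfl⟩
        by_contra hc
        rw [rowBead_of_colLen_le (by omega)] at h
        omega
    rw [this, hk]
    by_cases h1 : k < 0 <;> by_cases h2 : k ∈ D <;> simp [h1, h2] <;> omega
  have hinj : Set.InjOn (fun i => rowBead μ i + n) (Finset.range N : Finset ℕ) := by
    intro i _ j _ h
    exact (rowBead_strictAnti μ).injective (by simpa using h)
  have hneg : D.filter (¬ 0 ≤ ·) = Finset.Ico (n - N) 0 ∩ D := by
    ext k
    simp only [Finset.mem_filter, Finset.mem_inter, Finset.mem_Ico]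
    have hk := hD k
    have hl := hlow k
    by_cases h : k < n - N
    · have := hl h
      have : k < 0 := by omega
      tauto
    · constructor
      · rintro ⟨h1, h2⟩
        exact ⟨⟨by omega, by omega⟩, h1⟩
      · rintro ⟨⟨h1, h2⟩, h3⟩
        exact ⟨h3, by omega⟩
  rw [← Finset.sum_image (f := G) hinj, himage, Finset.sum_union, signedSum,
    ← Finset.sum_filter_add_sum_filter_not D (0 ≤ ·),
    Finset.sum_congr rfl fun k hk => if_pos (Finset.mem_filter.1 hk).2,
    Finset.sum_congr (s₁ := D.filter (¬ 0 ≤ ·)) rfl fun k hk => if_neg (Finset.mem_filter.1 hk).2,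
    hneg, ← Finset.sum_inter_add_sum_sdiff (Finset.Ico (n - N) 0) D, Finset.sum_neg_distrib]
  · abel
  · rw [Finset.disjoint_left]
    intro k hk
    simp only [Finset.mem_filter] at hk
    simp [hk]

theorem signedSum_eq_add_sum_cells {D D₀ : Finset ℤ} {μ : YoungDiagram} {n : ℤ}
    (hD : IsExcitation D (beads μ n)) (hD₀ : IsExcitation D₀ (beads ⊥ n)) (G : ℤ → M) :
    signedSum G D =
      signedSum G D₀ + ∑ u ∈ μ.cells, (G (u.2 - u.1 + n) - G (u.2 - u.1 - 1 + n)) := by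
  have hbot : (⊥ : YoungDiagram).colLen 0 = 0 := by
    by_contra h
    exact YoungDiagram.notMem_bot _ (YoungDiagram.mem_iff_lt_colLen.2 (Nat.pos_of_ne_zero h))
  have hN := le_max_left (μ.colLen 0) n.toNat
  have hn : n ≤ (max (μ.colLen 0) n.toNat : ℕ) := by omega
  rw [signedSum_eq_sum_range hD G hN hn, signedSum_eq_sum_range hD₀ G (by omega) hn,
    sum_cells_eq μ (fun i j => G (j - i + n) - G (j - i - 1 + n)) hN, sub_add_eq_add_sub,
    ← Finset.sum_add_distrib]
  congr 1
  refine Finset.sum_congr rfl fun i _ => ?_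
  rw [rowBead_of_colLen_le (μ := ⊥) (by omega)]
  have := Finset.sum_range_sub (fun j : ℕ => G ((j : ℤ) - i - 1 + n)) (μ.rowLen i)
  rw [eq_comm, add_comm, ← eq_sub_iff_add_eq]
  refine Eq.trans (Finset.sum_congr rfl fun j _ => ?_) (this.trans ?_)
  · push_cast
    congr 2
    ring
  · unfold rowBead
    push_cast
    congr 2
    ring

end Energy

section Symmetry

@[to_additive]
theorem prod_eq_prod_filter_mul_involution {α M : Type*} [CommMonoid M] {s : Finset α} {σ : α → α}
    (hσ : Function.Involutive σ) (hs : ∀ a ∈ s, σ a ∈ s) (p : α → Prop) [DecidablePred p]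
    (hp : ∀ a ∈ s, p (σ a) ↔ ¬ p a) (g : α → M) :
    ∏ a ∈ s, g a = ∏ a ∈ s with p a, g a * g (σ a) := by
  rw [← Finset.prod_filter_mul_prod_filter_not s p, Finset.prod_mul_distrib]
  congr 1
  refine Finset.prod_bij' (fun a _ => σ a) (fun a _ => σ a) ?_ ?_ ?_ ?_ ?_
  · intro a ha
    rw [Finset.mem_filter] at ha ⊢
    exact ⟨hs a ha.1, (hp a ha.1).2 ha.2⟩
  · intro a ha
    rw [Finset.mem_filter] at ha ⊢
    exact ⟨hs a ha.1, fun h => (hp a ha.1).1 h ha.2⟩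
  · exact fun a _ => hσ a
  · exact fun a _ => hσ a
  · exact fun a _ => by rw [hσ a]

theorem emod_and_ediv_eq {m : ℕ} {c k l : ℤ} (h0 : 0 ≤ c) (h1 : c < 2 * m)
    (h : l = c + 2 * m * k) : l % (2 * m) = c ∧ l / (2 * m) = k :=
  ((Int.ediv_emod_unique (by omega)).2 ⟨h.symm, h0, h1⟩).symm

theorem emod_and_ediv_reflect {m : ℕ} (hm : 0 < m) (k : ℤ) :
    (-1 - k) % (2 * m) = 2 * m - 1 - k % (2 * m) ∧ (-1 - k) / (2 * m) = -1 - k / (2 * m) := by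
  have h1 := Int.emod_nonneg k (b := 2 * m) (by omega)
  have h2 := Int.emod_lt_of_pos k (b := 2 * m) (by omega)
  have h3 := Int.emod_add_mul_ediv k (2 * m)
  refine emod_and_ediv_eq (by omega) (by omega) ?_
  linear_combination h3

theorem lt_iff_reflect {m : ℕ} (hm : 0 < m) (k : ℤ) :
    (-1 - k) % (2 * m) < m ↔ ¬ k % (2 * m) < m := by
  rw [(emod_and_ediv_reflect hm k).1]
  omega

theorem involutive_reflect : Function.Involutive fun k : ℤ => -1 - k := fun k => by
  dsimp only
  ring

/-- The Maya diagrams of self-conjugate partitions. -/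
def IsReflective (S : Set ℤ) : Prop := ∀ k, k ∈ S ↔ -1 - k ∉ S

theorem isReflective_beads_iff {μ : YoungDiagram} {n : ℤ} :
    IsReflective (beads μ n) ↔ n = 0 ∧ μ ∈ SC := by
  have h : IsReflective (beads μ n) ↔ beads μ n = beads μ.transpose (-n) := by
    rw [Set.ext_iff]
    exact forall_congr' fun k => by rw [mem_beads_transpose]
  rw [h]
  constructor
  · intro h
    have := beads_injective h
    exact ⟨by omega, this.1.symm⟩
  · rintro ⟨rfl, h2⟩
    rw [neg_zero, show μ.transpose = μ from h2]

theorem exists_beads_lower (μ : YoungDiagram) (n : ℤ) : ∃ L, ∀ k < L, k ∈ beads μ n :=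
  ⟨n - μ.colLen 0, fun k hk =>
    ⟨(n - 1 - k).toNat, by rw [rowBead_of_colLen_le (by omega)]; omega⟩⟩

theorem exists_beads_upper (μ : YoungDiagram) (n : ℤ) : ∃ U, ∀ k, U < k → k ∉ beads μ n := by
  refine ⟨rowBead μ 0 + n, ?_⟩
  rintro _ hk ⟨i, rfl⟩
  have := (rowBead_strictAnti μ).antitone (Nat.zero_le i)
  omega

theorem exists_isExcitation (μ : YoungDiagram) (n : ℤ) : ∃ D, IsExcitation D (beads μ n) := by
  classical
  obtain ⟨L, hL⟩ := exists_beads_lower μ n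
  obtain ⟨U, hU⟩ := exists_beads_upper μ n
  refine ⟨(Finset.Icc L U ∪ Finset.Icc L 0 ∪ Finset.Icc 0 U).filter
    fun k => ¬ (k ∈ beads μ n ↔ k < 0), fun k => ?_⟩
  simp only [Finset.mem_filter, Finset.mem_union, Finset.mem_Icc]
  have h1 := hL k
  have h2 := hU k
  by_cases hk : k ∈ beads μ n
  · have : k ≤ U := not_lt.1 fun h => h2 h hk
    simp only [hk, true_iff]
    omega
  · have : L ≤ k := not_lt.1 fun h => hk (h1 h)
    simp only [hk, false_iff]
    omega

end Symmetry

section Runners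

/-- The beads of `S` on the runner of the abacus with `2 * m` runners passing through `c`. -/
def runner (m : ℕ) (S : Set ℤ) (c : ℤ) : Set ℤ := {k | c + 2 * m * k ∈ S}

variable {m : ℕ}

/-- `q` lists the charges and the partitions on the first half of the runners of the
self-conjugate partition `μ`. -/
def IsQuotient (μ : YoungDiagram) (q : Fin m → ℤ × YoungDiagram) : Prop :=
  μ ∈ SC ∧ ∀ c, beads (q c).2 (q c).1 = runner m (beads μ 0) (c : ℕ)

theorem exists_isQuotient {μ : YoungDiagram} (hμ : μ ∈ SC) :
    ∃ q : Fin m → ℤ × YoungDiagram, IsQuotient μ q := by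
  have : ∀ c : Fin m, ∃ p : ℤ × YoungDiagram, beads p.2 p.1 = runner m (beads μ 0) (c : ℕ) := by
    intro c
    have hm : 0 < m := c.pos
    have hc := c.2
    obtain ⟨L, hL⟩ := exists_beads_lower μ 0
    obtain ⟨U, hU⟩ := exists_beads_upper μ 0
    obtain ⟨ν, n, h⟩ := exists_beads_eq (S := runner m (beads μ 0) (c : ℕ))
      (L := -|L| - 1) (U := |U|)
      (fun k hk => hL _ (by nlinarith [neg_abs_le L, abs_nonneg L]))
      (fun k hk => hU _ (by nlinarith [le_abs_self U, abs_nonneg U]))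
    exact ⟨(n, ν), h⟩
  choose q hq using this
  exact ⟨q, hμ, hq⟩

theorem IsQuotient.eq_right {μ : YoungDiagram} {q q' : Fin m → ℤ × YoungDiagram}
    (h : IsQuotient μ q) (h' : IsQuotient μ q') : q = q' := by
  funext c
  have := beads_injective ((h.2 c).trans (h'.2 c).symm)
  exact Prod.ext this.2 this.1

theorem IsQuotient.mem_iff {μ : YoungDiagram} {q : Fin m → ℤ × YoungDiagram}
    (h : IsQuotient μ q) (c : Fin m) (k : ℤ) :
    k ∈ beads (q c).2 (q c).1 ↔ (c : ℕ) + 2 * m * k ∈ beads μ 0 := by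
  rw [h.2 c]
  rfl

theorem IsQuotient.eq_left (hm : 0 < m) {μ μ' : YoungDiagram} {q : Fin m → ℤ × YoungDiagram}
    (h : IsQuotient μ q) (h' : IsQuotient μ' q) : μ = μ' := by
  have hr := isReflective_beads_iff.2 ⟨rfl, h.1⟩
  have hr' := isReflective_beads_iff.2 ⟨rfl, h'.1⟩
  have low : ∀ k : ℤ, k % (2 * m) < m → (k ∈ beads μ 0 ↔ k ∈ beads μ' 0) := by
    intro k hk
    have h0 := Int.emod_nonneg k (b := 2 * m) (by omega)
    have e : k = ((⟨(k % (2 * m)).toNat, by omega⟩ : Fin m) : ℕ) + 2 * m * (k / (2 * m)) := by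
      have := Int.emod_add_mul_ediv k (2 * m)
      dsimp only
      omega
    rw [e, ← h.mem_iff, ← h'.mem_iff]
  refine (beads_injective (n := 0) (n' := 0) ?_).1
  ext k
  by_cases hk : k % (2 * m) < m
  · exact low k hk
  · rw [hr k, hr' k, low _ ((lt_iff_reflect hm k).2 hk)]

theorem exists_isQuotient_left (hm : 0 < m) (q : Fin m → ℤ × YoungDiagram) :
    ∃ μ, IsQuotient μ q := by
  classical
  let f : ℤ → Set ℤ := fun c =>
    if h : c.toNat < m then beads (q ⟨c.toNat, h⟩).2 (q ⟨c.toNat, h⟩).1 else ∅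
  have hf : ∀ c : Fin m, f (c : ℕ) = beads (q c).2 (q c).1 := by
    intro c
    have : ((c : ℕ) : ℤ).toNat < m := by simp
    simp [f]
  have hex : ∀ k : ℤ, k % (2 * m) < m → ∃ c : Fin m, (c : ℕ) = k % (2 * m) := by
    intro k hk
    have h0 := Int.emod_nonneg k (b := 2 * m) (by omega)
    exact ⟨⟨(k % (2 * m)).toNat, by omega⟩, by dsimp only; omega⟩
  let low : Set ℤ := {k | k / (2 * m) ∈ f (k % (2 * m))}
  let S : Set ℤ := {k | if k % (2 * m) < m then k ∈ low else -1 - k ∉ low}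
  have hS : ∀ k, k ∈ S ↔ if k % (2 * m) < m then k ∈ low else -1 - k ∉ low := fun k => Iff.rfl
  have hrefl : IsReflective S := by
    intro k
    rw [hS, hS]
    have := lt_iff_reflect hm k
    by_cases h : k % (2 * m) < m
    · rw [if_pos h, if_neg (by tauto), show -1 - (-1 - k) = k by ring, not_not]
    · rw [if_neg h, if_pos (by tauto)]
  have hbound : ∃ L : ℤ, L ≤ 0 ∧ ∀ c : Fin m, ∀ k,
      (k < L → k ∈ f (c : ℕ)) ∧ (-1 - L < k → k ∉ f (c : ℕ)) := by
    choose L hL using fun c : Fin m => exists_beads_lower (q c).2 (q c).1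
    choose U hU using fun c : Fin m => exists_beads_upper (q c).2 (q c).1
    have hle : ∀ c : Fin m, |L c| + |U c| ≤ ∑ c, (|L c| + |U c|) := fun c =>
      Finset.single_le_sum (f := fun c => |L c| + |U c|) (fun c _ => by positivity)
        (Finset.mem_univ c)
    refine ⟨-(∑ c, (|L c| + |U c|)) - 1, ?_, fun c k => ⟨fun h => ?_, fun h => ?_⟩⟩
    · have : 0 ≤ ∑ c, (|L c| + |U c|) := by positivity
      omega
    · rw [hf]
      have := hle c
      have := neg_abs_le (L c)
      have := abs_nonneg (U c)
      exact hL c k (by omega)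
    · rw [hf]
      have := hle c
      have := le_abs_self (U c)
      have := abs_nonneg (L c)
      exact hU c k (by omega)
  obtain ⟨L, hL0, hL⟩ := hbound
  have hlowS : ∀ k < 2 * m * L, k ∈ S := by
    intro k hk
    have hdiv : k / (2 * m) < L := Int.ediv_lt_of_lt_mul (by omega) (by linarith)
    have hr := emod_and_ediv_reflect hm k
    rw [hS]
    split_ifs with h
    · obtain ⟨c, hc⟩ := hex k h
      change k / (2 * m) ∈ f (k % (2 * m))
      rw [← hc]
      exact (hL c _).1 hdiv
    · obtain ⟨c, hc⟩ := hex _ ((lt_iff_reflect hm k).2 h)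
      change (-1 - k) / (2 * m) ∉ f ((-1 - k) % (2 * m))
      rw [← hc]
      refine (hL c _).2 ?_
      rw [hr.2]
      omega
  obtain ⟨μ, n, hμ⟩ := exists_beads_eq (S := S) (L := 2 * m * L) (U := -1 - 2 * m * L) hlowS
    (fun k hk => by
      have := hlowS (-1 - k) (by linarith)
      rw [hrefl, show -1 - (-1 - k) = k by ring] at this
      exact this)
  obtain ⟨rfl, hSC⟩ := isReflective_beads_iff.1 (hμ ▸ hrefl)
  refine ⟨μ, hSC, fun c => ?_⟩
  ext k
  have hc := c.2
  obtain ⟨h1, h2⟩ := emod_and_ediv_eq (m := m) (c := (c : ℕ)) (k := k) (by omega) (by omega) rfl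
  change _ ↔ _ ∈ beads μ 0
  rw [hμ, hS, h1, if_pos (by omega)]
  change _ ↔ _ / (2 * m : ℤ) ∈ f (_ % (2 * m))
  rw [h1, h2, hf]

/-- Self-conjugate partitions correspond to tuples of charged partitions. -/
noncomputable def quotientEquiv (hm : 0 < m) : SC ≃ (Fin m → ℤ × YoungDiagram) :=
  Equiv.ofBijective (fun μ => (exists_isQuotient (m := m) μ.2).choose)
    ⟨fun μ μ' h => Subtype.ext <| (exists_isQuotient (m := m) μ.2).choose_spec.eq_left hm
      (by dsimp only at h; rw [h]; exact (exists_isQuotient (m := m) μ'.2).choose_spec),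
    fun q => by
      obtain ⟨μ, hμ⟩ := exists_isQuotient_left hm q
      exact ⟨⟨μ, hμ.1⟩, (exists_isQuotient (m := m) hμ.1).choose_spec.eq_right hμ⟩⟩

theorem isQuotient_quotientEquiv (hm : 0 < m) (μ : SC) :
    IsQuotient μ.1 (quotientEquiv hm μ) :=
  (exists_isQuotient (m := m) μ.2).choose_spec

end Runners

section QuotientHooks

variable {m : ℕ}

theorem rowBead_of_mem_SC {μ : YoungDiagram} (hμ : μ ∈ SC) (i : ℕ) :
    rowBead μ i = -1 - colBead μ i := by
  rw [← rowBead_transpose, show μ.transpose = μ from hμ]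

theorem swap_mem_of_mem_SC {μ : YoungDiagram} (hμ : μ ∈ SC) {u : ℕ × ℕ} (hu : u ∈ μ) :
    u.swap ∈ μ := by
  rw [← YoungDiagram.mem_transpose, show μ.transpose = μ from hμ]
  exact hu

theorem hookLength_swap {μ : YoungDiagram} (hμ : μ ∈ SC) {u : ℕ × ℕ} (hu : u ∈ μ) :
    hookLength μ u.swap = hookLength μ u := by
  have h1 := hookLength_eq hu
  have h2 := hookLength_eq (swap_mem_of_mem_SC hμ hu)
  have h3 := rowBead_of_mem_SC hμ u.1
  have h4 := rowBead_of_mem_SC hμ u.2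
  rw [Prod.fst_swap, Prod.snd_swap] at h2
  omega

theorem mem_boxes {t : ℕ} {μ : YoungDiagram} {u : ℕ × ℕ} :
    u ∈ boxes t μ ↔ u ∈ μ ∧ (t : ℤ) ∣ rowBead μ u.1 - colBead μ u.2 := by
  unfold boxes
  rw [Finset.mem_filter, YoungDiagram.mem_cells]
  refine and_congr_right fun hu => ?_
  rw [← hookLength_eq hu, Int.natCast_dvd_natCast]

theorem IsQuotient.bijOn_cells {μ : YoungDiagram} {q : Fin m → ℤ × YoungDiagram}
    (h : IsQuotient μ q) :
    Set.BijOn (fun s : (_ : Fin m) × (ℕ × ℕ) =>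
        (((s.1 : ℕ) + 2 * m * (colBead (q s.1).2 s.2.2 + (q s.1).1) : ℤ),
          ((s.1 : ℕ) + 2 * m * (rowBead (q s.1).2 s.2.1 + (q s.1).1) : ℤ)))
      (Finset.univ.sigma fun c => (q c).2.cells : Finset _)
      {p ∈ inversions (beads μ 0) | ((2 * m : ℕ) : ℤ) ∣ p.2 - p.1 ∧ p.1 % (2 * m) < m} := by
  refine ⟨?_, ?_, ?_⟩
  · rintro ⟨c, u⟩ hu
    rw [Finset.mem_coe, Finset.mem_sigma] at hu
    have hc := c.2
    obtain ⟨h1, h2, h3⟩ := (bijOn_inversions (q c).2 (q c).1).mapsTo hu.2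
    rw [h.mem_iff] at h1 h2
    refine ⟨⟨h1, h2, ?_⟩, ?_, ?_⟩
    · dsimp only at h3 ⊢
      have : (0 : ℤ) < 2 * m := by omega
      have := mul_lt_mul_of_pos_left h3 this
      omega
    · exact ⟨rowBead (q c).2 u.1 - colBead (q c).2 u.2, by push_cast; ring⟩
    · dsimp only
      rw [(emod_and_ediv_eq (by omega) (by omega) rfl).1]
      omega
  · rintro ⟨c, u⟩ hu ⟨c', u'⟩ hu' he
    rw [Finset.mem_coe, Finset.mem_sigma] at hu hu'
    have hc := c.2
    have hc' := c'.2
    simp only [Prod.mk.injEq] at he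
    have h1 := emod_and_ediv_eq (m := m) (c := (c' : ℕ)) (by omega) (by omega) he.1
    have h1' := emod_and_ediv_eq (m := m) (c := (c : ℕ)) (by omega) (by omega)
      (Eq.refl ((c : ℕ) + 2 * m * (colBead (q c).2 u.2 + (q c).1) : ℤ))
    have hcc : c = c' := by
      have := h1.1.symm.trans h1'.1
      ext
      omega
    subst hcc
    have h2 := emod_and_ediv_eq (m := m) (c := (c : ℕ)) (by omega) (by omega) he.2
    have h2' := emod_and_ediv_eq (m := m) (c := (c : ℕ)) (by omega) (by omega)
      (Eq.refl ((c : ℕ) + 2 * m * (rowBead (q c).2 u.1 + (q c).1) : ℤ))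
    have := (bijOn_inversions (q c).2 (q c).1).injOn hu.2 hu'.2
      (Prod.ext (h1'.2.symm.trans h1.2) (h2'.2.symm.trans h2.2))
    dsimp only at this
    rw [this]
  · rintro ⟨a, b⟩ ⟨⟨ha, hb, hab⟩, ⟨d, hd⟩, hlow⟩
    dsimp only at ha hb hab hd hlow
    have hm : 0 < m := by
      by_contra hc
      have : m = 0 := by omega
      subst this
      simp at hd
      omega
    have h0 := Int.emod_nonneg a (b := 2 * m) (by omega)
    have h3 := Int.emod_add_mul_ediv a (2 * m)
    obtain ⟨c, hc⟩ : ∃ c : Fin m, (c : ℕ) = a % (2 * m) :=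
      ⟨⟨(a % (2 * m)).toNat, by omega⟩, by dsimp only; omega⟩
    have ea : a = (c : ℕ) + 2 * m * (a / (2 * m)) := by omega
    have eb : b = (c : ℕ) + 2 * m * (a / (2 * m) + d) := by
      push_cast at hd
      linear_combination hd + ea
    rw [ea, ← h.mem_iff] at ha
    rw [eb, ← h.mem_iff] at hb
    have hd0 : 0 < d := by
      have h4 : (0 : ℤ) < ((2 * m : ℕ) : ℤ) * d := by omega
      exact pos_of_mul_pos_right h4 (by positivity)
    obtain ⟨u, hu, he⟩ := (bijOn_inversions (q c).2 (q c).1).surjOn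
      (show (a / (2 * m), a / (2 * m) + d) ∈ _ from ⟨ha, hb, by dsimp only; omega⟩)
    simp only [Prod.mk.injEq] at he
    refine ⟨⟨c, u⟩, by simpa using hu, ?_⟩
    dsimp only
    rw [he.1, he.2, ← ea, ← eb]

theorem bijOn_boxes (m : ℕ) (μ : YoungDiagram) :
    Set.BijOn (fun u : ℕ × ℕ => (colBead μ u.2, rowBead μ u.1))
      ((boxes (2 * m) μ).filter fun u => colBead μ u.2 % (2 * m) < m : Finset _)
      {p ∈ inversions (beads μ 0) | ((2 * m : ℕ) : ℤ) ∣ p.2 - p.1 ∧ p.1 % (2 * m) < m} := by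
  have h := bijOn_inversions μ 0
  simp only [add_zero] at h
  refine ⟨?_, ?_, ?_⟩
  · intro u hu
    rw [Finset.mem_coe, Finset.mem_filter, mem_boxes] at hu
    exact ⟨h.mapsTo hu.1.1, hu.1.2, hu.2⟩
  · intro u hu v hv he
    rw [Finset.mem_coe, Finset.mem_filter, mem_boxes] at hu hv
    exact h.injOn hu.1.1 hv.1.1 he
  · rintro p ⟨hp, hd⟩
    obtain ⟨u, hu, rfl⟩ := h.surjOn hp
    exact ⟨u, by rw [Finset.mem_coe, Finset.mem_filter, mem_boxes]; exact ⟨⟨hu, hd.1⟩, hd.2⟩, rfl⟩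

@[to_additive]
theorem IsQuotient.prod_boxes_low {M : Type*} [CommMonoid M] {μ : YoungDiagram}
    {q : Fin m → ℤ × YoungDiagram} (h : IsQuotient μ q) (ψ : ℤ → M) :
    ∏ u ∈ boxes (2 * m) μ with colBead μ u.2 % (2 * m) < m, ψ (hookLength μ u) =
      ∏ c, ∏ v ∈ (q c).2.cells, ψ ((2 * m : ℕ) * hookLength (q c).2 v) := by
  rw [Finset.prod_sigma', ← finprod_mem_coe_finset, ← finprod_mem_coe_finset]
  rw [finprod_mem_eq_of_bijOn (g := fun p : ℤ × ℤ => ψ (p.2 - p.1)) _ (bijOn_boxes m μ),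
    finprod_mem_eq_of_bijOn (g := fun p : ℤ × ℤ => ψ (p.2 - p.1)) _ h.bijOn_cells]
  · rintro ⟨c, u⟩ hu
    rw [Finset.mem_coe, Finset.mem_sigma] at hu
    dsimp only
    rw [hookLength_eq ((YoungDiagram.mem_cells _).1 hu.2)]
    congr 1
    push_cast
    ring
  · intro u hu
    rw [Finset.mem_coe, Finset.mem_filter, mem_boxes] at hu
    rw [hookLength_eq hu.1.1]

theorem fst_ne_snd_of_mem_boxes {μ : YoungDiagram} (hμ : μ ∈ SC) {u : ℕ × ℕ}
    (hu : u ∈ boxes (2 * m) μ) : u.1 ≠ u.2 := by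
  intro he
  obtain ⟨d, hd⟩ := (mem_boxes.1 hu).2
  rw [rowBead_of_mem_SC hμ, he] at hd
  push_cast at hd
  rw [mul_assoc] at hd
  omega

@[to_additive]
theorem IsQuotient.prod_boxes {M : Type*} [CommMonoid M] (hm : 0 < m) {μ : YoungDiagram}
    {q : Fin m → ℤ × YoungDiagram} (h : IsQuotient μ q) (φ : ℤ × ℤˣ → M) :
    ∏ u ∈ boxes (2 * m) μ, φ (hookLength μ u, boxSign u) =
      ∏ c, ∏ v ∈ (q c).2.cells, φ ((2 * m : ℕ) * hookLength (q c).2 v, 1) *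
        φ ((2 * m : ℕ) * hookLength (q c).2 v, -1) := by
  have hμ := h.1
  rw [prod_eq_prod_filter_mul_involution (σ := Prod.swap) Prod.swap_swap ?_
    (fun u => colBead μ u.2 % (2 * m) < m) ?_,
    ← h.prod_boxes_low fun k => φ (k, 1) * φ (k, -1)]
  · refine Finset.prod_congr rfl fun u hu => ?_
    have hu' := (Finset.mem_filter.1 hu).1
    rw [hookLength_swap hμ (mem_boxes.1 hu').1]
    have hne := fst_ne_snd_of_mem_boxes hμ hu'
    unfold boxSign
    rw [Prod.fst_swap, Prod.snd_swap]
    split_ifs with h1 h2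
    · omega
    · rw [mul_comm]
    · rfl
    · omega
  · intro u hu
    have h1 := (mem_boxes.1 hu).1
    have h2 := (mem_boxes.1 hu).2
    have h3 := swap_mem_of_mem_SC hμ h1
    rw [mem_boxes, ← hookLength_eq h3, hookLength_swap hμ h1, hookLength_eq h1]
    exact ⟨h3, h2⟩
  · intro u hu
    obtain ⟨d, hd⟩ := (mem_boxes.1 hu).2
    have : colBead μ u.swap.2 = -1 - rowBead μ u.1 := by
      rw [rowBead_of_mem_SC hμ, Prod.snd_swap]
      ring
    rw [this, lt_iff_reflect hm, show rowBead μ u.1 = colBead μ u.2 + 2 * m * d by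
      push_cast at hd; linarith, Int.add_mul_emod_self_left]

end QuotientHooks

section QuotientEnergy

variable {m : ℕ} {M : Type*} [AddCommGroup M]

theorem isExcitation_empty : IsExcitation ∅ (beads ⊥ 0) := by
  have hbot : ∀ i, (⊥ : YoungDiagram).rowLen i = 0 := by
    intro i
    by_contra h
    exact YoungDiagram.notMem_bot _ (YoungDiagram.mem_iff_lt_rowLen.2 (Nat.pos_of_ne_zero h))
  intro k
  simp only [Finset.notMem_empty, not_false_eq_true, iff_true]
  constructor
  · rintro ⟨i, rfl⟩
    rw [rowBead, hbot]
    omega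
  · intro hk
    exact ⟨(-1 - k).toNat, by rw [rowBead, hbot]; omega⟩

theorem signedSum_eq_sum_cells {D : Finset ℤ} {μ : YoungDiagram}
    (hD : IsExcitation D (beads μ 0)) (G : ℤ → M) :
    signedSum G D = ∑ u ∈ μ.cells, (G (u.2 - u.1) - G (u.2 - u.1 - 1)) := by
  rw [signedSum_eq_add_sum_cells hD isExcitation_empty]
  simp [signedSum]

theorem IsExcitation.reflect_mem_iff {D : Finset ℤ} {S : Set ℤ} (hD : IsExcitation D S)
    (hS : IsReflective S) (k : ℤ) : -1 - k ∈ D ↔ k ∈ D := by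
  have h1 := hD k
  have h2 := hD (-1 - k)
  have h3 := hS k
  have h4 : -1 - k < 0 ↔ ¬ k < 0 := by omega
  tauto

theorem signedSum_eq_sum_filter {D : Finset ℤ} {S : Set ℤ} (hD : IsExcitation D S)
    (hS : IsReflective S) (p : ℤ → Prop) [DecidablePred p] (hp : ∀ k, p (-1 - k) ↔ ¬ p k)
    (G : ℤ → M) :
    signedSum G D = ∑ k ∈ D with p k,
      if 0 ≤ k then G k - G (-1 - k) else -(G k - G (-1 - k)) := by
  unfold signedSum
  rw [sum_eq_sum_filter_add_involution involutive_reflect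
    (fun k hk => (hD.reflect_mem_iff hS k).2 hk) p fun k _ => hp k]
  refine Finset.sum_congr rfl fun k _ => ?_
  split_ifs
  · omega
  · abel
  · abel
  · omega

theorem IsQuotient.signedSum_eq (hm : 0 < m) {μ : YoungDiagram} {q : Fin m → ℤ × YoungDiagram}
    (h : IsQuotient μ q) {D : Finset ℤ} (hD : IsExcitation D (beads μ 0)) {E : Fin m → Finset ℤ}
    (hE : ∀ c, IsExcitation (E c) (beads (q c).2 (q c).1)) (G : ℤ → M) :
    signedSum G D = ∑ c : Fin m, signedSum
      (fun k => G ((c : ℕ) + 2 * m * k) - G (-1 - ((c : ℕ) + 2 * m * k))) (E c) := by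
  have hneg : ∀ (c : Fin m) (k : ℤ), ((c : ℕ) : ℤ) + 2 * m * k < 0 ↔ k < 0 := by
    intro c k
    have hc := c.2
    constructor
    · intro h
      by_contra hk
      have : 0 ≤ (m : ℤ) * k := by
        have := not_lt.1 hk
        positivity
      linarith
    · intro h
      nlinarith
  have hmem : ∀ c k, k ∈ E c ↔ ((c : ℕ) : ℤ) + 2 * m * k ∈ D := by
    intro c k
    have h1 := hD ((c : ℕ) + 2 * m * k)
    have h2 := hE c k
    have h3 := h.mem_iff c k
    rw [hneg] at h1
    tauto
  unfold signedSum
  rw [← signedSum, signedSum_eq_sum_filter hD (isReflective_beads_iff.2 ⟨rfl, h.1⟩)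
    (fun k => k % (2 * m) < m) (lt_iff_reflect hm), Finset.sum_sigma', eq_comm]
  refine Finset.sum_bij (fun s _ => ((s.1 : ℕ) + 2 * m * s.2 : ℤ)) ?_ ?_ ?_ ?_
  · rintro ⟨c, k⟩ hs
    have hc := c.2
    rw [Finset.mem_sigma] at hs
    rw [Finset.mem_filter, (emod_and_ediv_eq (by omega) (by omega) rfl).1]
    exact ⟨(hmem c k).1 hs.2, by dsimp only; omega⟩
  · rintro ⟨c, k⟩ hs ⟨c', k'⟩ hs' he
    have hc := c.2
    have hc' := c'.2
    dsimp only at he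
    have h1 := emod_and_ediv_eq (m := m) (c := (c' : ℕ)) (by omega) (by omega) he
    have h2 := emod_and_ediv_eq (m := m) (c := (c : ℕ)) (k := k) (by omega) (by omega) rfl
    have hcc : c = c' := by
      have := h1.1.symm.trans h2.1
      ext
      omega
    have hkk : k = k' := h2.2.symm.trans h1.2
    rw [hcc, hkk]
  · intro d hd
    rw [Finset.mem_filter] at hd
    have h0 := Int.emod_nonneg d (b := 2 * m) (by omega)
    have h3 := Int.emod_add_mul_ediv d (2 * m)
    obtain ⟨c, hc⟩ : ∃ c : Fin m, (c : ℕ) = d % (2 * m) :=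
      ⟨⟨(d % (2 * m)).toNat, by omega⟩, by dsimp only; omega⟩
    have ed : (c : ℕ) + 2 * m * (d / (2 * m)) = d := by omega
    refine ⟨⟨c, d / (2 * m)⟩, ?_, ed⟩
    rw [Finset.mem_sigma, hmem]
    exact ⟨Finset.mem_univ _, by dsimp only; rw [ed]; exact hd.1⟩
  · rintro ⟨c, k⟩ hs
    have := hneg c k
    dsimp only
    split_ifs
    · rfl
    · omega
    · omega
    · rfl

/-- Comparison of an additive statistic of the contents on a self-conjugate partition and on its
core. -/
theorem IsQuotient.sum_cells_eq (hm : 0 < m) {μ μ₀ : YoungDiagram} {q : Fin m → ℤ × YoungDiagram}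
    (h : IsQuotient μ q) (h₀ : IsQuotient μ₀ fun c => ((q c).1, ⊥)) (G : ℤ → M) (δ : M)
    (hG : ∀ (c : Fin m) k, G ((c : ℕ) + 2 * m * (k + 1)) - G (-1 - ((c : ℕ) + 2 * m * (k + 1))) =
      G ((c : ℕ) + 2 * m * k) - G (-1 - ((c : ℕ) + 2 * m * k)) + δ) :
    ∑ u ∈ μ.cells, (G (u.2 - u.1) - G (u.2 - u.1 - 1)) =
      ∑ u ∈ μ₀.cells, (G (u.2 - u.1) - G (u.2 - u.1 - 1)) + (∑ c, (q c).2.card) • δ := by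
  obtain ⟨D, hD⟩ := exists_isExcitation μ 0
  obtain ⟨D₀, hD₀⟩ := exists_isExcitation μ₀ 0
  choose E hE using fun c => exists_isExcitation (q c).2 (q c).1
  choose E₀ hE₀ using fun c => exists_isExcitation ⊥ (q c).1
  rw [← signedSum_eq_sum_cells hD, ← signedSum_eq_sum_cells hD₀, h.signedSum_eq hm hD hE,
    h₀.signedSum_eq hm hD₀ hE₀, Finset.sum_smul, ← Finset.sum_add_distrib]
  refine Finset.sum_congr rfl fun c _ => ?_
  rw [signedSum_eq_add_sum_cells (hE c) (hE₀ c)]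
  congr 1
  rw [YoungDiagram.card, ← Finset.sum_const]
  refine Finset.sum_congr rfl fun u _ => ?_
  have := hG c (u.2 - u.1 - 1 + (q c).1)
  rw [sub_eq_iff_eq_add', ← this]
  congr 3 <;> ring

theorem card_eq_sum (μ : YoungDiagram) :
    (μ.card : ℤ) = ∑ u ∈ μ.cells, ((u.2 - u.1 : ℤ) - (u.2 - u.1 - 1)) := by
  simp [YoungDiagram.card]

theorem bgRank_eq_sum (μ : YoungDiagram) : bgRank μ = ∑ u ∈ μ.cells,
    ((if Even (u.2 - u.1 : ℤ) then 1 else 0) - if Even (u.2 - u.1 - 1 : ℤ) then 1 else 0) := by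
  refine Finset.sum_congr rfl fun u _ => ?_
  rcases Nat.even_or_odd (u.1 + u.2) with h | h
  · have h1 : Even (u.2 - u.1 : ℤ) := by
      rw [Int.even_sub]
      rw [Nat.even_add] at h
      simpa only [Int.even_coe_nat] using h.symm
    rw [if_pos h1, if_neg (by rw [Int.even_sub_one]; simpa using h1), h.neg_one_pow]
    rfl
  · have h1 : ¬ Even (u.2 - u.1 : ℤ) := by
      rw [Int.even_sub]
      rw [← Nat.not_even_iff_odd, Nat.even_add] at h
      simpa only [Int.even_coe_nat] using fun hc => h hc.symm
    rw [if_neg h1, if_pos (by rwa [Int.even_sub_one]), h.neg_one_pow]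
    rfl

theorem IsQuotient.card_eq (hm : 0 < m) {μ μ₀ : YoungDiagram} {q : Fin m → ℤ × YoungDiagram}
    (h : IsQuotient μ q) (h₀ : IsQuotient μ₀ fun c => ((q c).1, ⊥)) :
    μ.card = μ₀.card + 4 * m * ∑ c, (q c).2.card := by
  have := h.sum_cells_eq hm h₀ (fun k => k) (4 * m) (fun c k => by ring)
  rw [← card_eq_sum, ← card_eq_sum, nsmul_eq_mul] at this
  zify
  push_cast at this
  rw [this]
  ring

theorem IsQuotient.bgRank_eq (hm : 0 < m) {μ μ₀ : YoungDiagram} {q : Fin m → ℤ × YoungDiagram}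
    (h : IsQuotient μ q) (h₀ : IsQuotient μ₀ fun c => ((q c).1, ⊥)) :
    bgRank μ = bgRank μ₀ := by
  have := h.sum_cells_eq hm h₀ (fun k => if Even k then (1 : ℤ) else 0) 0 (fun c k => by
    simp [parity_simps])
  rw [← bgRank_eq_sum, ← bgRank_eq_sum, smul_zero, add_zero] at this
  exact this

end QuotientEnergy

section DiagonalHooks

/-- `D` is the set of the arm lengths of the diagonal boxes of the self-conjugate partition `μ`. -/
def IsDiagonal (μ : YoungDiagram) (D : Finset ℕ) : Prop :=
  μ ∈ SC ∧ ∀ d : ℕ, (d : ℤ) ∈ beads μ 0 ↔ d ∈ D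

theorem exists_isDiagonal {μ : YoungDiagram} (hμ : μ ∈ SC) : ∃ D, IsDiagonal μ D := by
  obtain ⟨D, hD⟩ := exists_isExcitation μ 0
  refine ⟨D.preimage Nat.cast Nat.cast_injective.injOn, hμ, fun d => ?_⟩
  have := hD d
  rw [Finset.mem_preimage]
  have : ¬ (d : ℤ) < 0 := by omega
  tauto

theorem IsDiagonal.eq_right {μ : YoungDiagram} {D D' : Finset ℕ} (h : IsDiagonal μ D)
    (h' : IsDiagonal μ D') : D = D' := by
  ext d
  rw [← h.2, h'.2]

theorem IsDiagonal.eq_left {μ μ' : YoungDiagram} {D : Finset ℕ} (h : IsDiagonal μ D)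
    (h' : IsDiagonal μ' D) : μ = μ' := by
  have hr := isReflective_beads_iff.2 ⟨rfl, h.1⟩
  have hr' := isReflective_beads_iff.2 ⟨rfl, h'.1⟩
  have low : ∀ k : ℤ, 0 ≤ k → (k ∈ beads μ 0 ↔ k ∈ beads μ' 0) := by
    intro k hk
    lift k to ℕ using hk
    rw [h.2, h'.2]
  refine (beads_injective (n := 0) (n' := 0) ?_).1
  ext k
  by_cases hk : 0 ≤ k
  · exact low k hk
  · rw [hr k, hr' k, low _ (by omega)]

theorem exists_isDiagonal_left (D : Finset ℕ) : ∃ μ, IsDiagonal μ D := by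
  classical
  let S : Set ℤ := {k | if 0 ≤ k then k.toNat ∈ D else (-1 - k).toNat ∉ D}
  have hS : ∀ k, k ∈ S ↔ if 0 ≤ k then k.toNat ∈ D else (-1 - k).toNat ∉ D := fun k => Iff.rfl
  have hrefl : IsReflective S := by
    intro k
    rw [hS, hS]
    by_cases h : 0 ≤ k
    · rw [if_pos h, if_neg (by omega), show -1 - (-1 - k) = k by ring, not_not]
    · rw [if_neg h, if_pos (by omega)]
  have hup : ∀ k : ℤ, (D.sup id : ℕ) < k → k ∉ S := by
    intro k hk
    rw [hS, if_pos (by omega)]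
    intro hc
    have : k.toNat ≤ D.sup id := Finset.le_sup (f := id) hc
    omega
  obtain ⟨μ, n, hμ⟩ := exists_beads_eq (S := S) (L := -1 - (D.sup id : ℕ)) (U := (D.sup id : ℕ))
    (fun k hk => (hrefl k).2 (hup _ (by omega))) hup
  obtain ⟨rfl, hSC⟩ := isReflective_beads_iff.1 (hμ ▸ hrefl)
  refine ⟨μ, hSC, fun d => ?_⟩
  rw [hμ, hS, if_pos (by omega), Int.toNat_natCast]

/-- Self-conjugate partitions correspond to finite sets of natural numbers. -/
noncomputable def diagonalEquiv : SC ≃ Finset ℕ :=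
  Equiv.ofBijective (fun μ => (exists_isDiagonal μ.2).choose)
    ⟨fun μ μ' h => Subtype.ext <| (exists_isDiagonal μ.2).choose_spec.eq_left
      (by dsimp only at h; rw [h]; exact (exists_isDiagonal μ'.2).choose_spec),
    fun D => by
      obtain ⟨μ, hμ⟩ := exists_isDiagonal_left D
      exact ⟨⟨μ, hμ.1⟩, (exists_isDiagonal hμ.1).choose_spec.eq_right hμ⟩⟩

theorem isDiagonal_diagonalEquiv (μ : SC) : IsDiagonal μ.1 (diagonalEquiv μ) :=
  (exists_isDiagonal μ.2).choose_spec

theorem IsDiagonal.sum_cells_eq {M : Type*} [AddCommGroup M] {μ : YoungDiagram} {D : Finset ℕ}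
    (h : IsDiagonal μ D) (G : ℤ → M) :
    ∑ u ∈ μ.cells, (G (u.2 - u.1) - G (u.2 - u.1 - 1)) = ∑ d ∈ D, (G d - G (-1 - d)) := by
  obtain ⟨E, hE⟩ := exists_isExcitation μ 0
  rw [← signedSum_eq_sum_cells hE, signedSum_eq_sum_filter hE
    (isReflective_beads_iff.2 ⟨rfl, h.1⟩) (0 ≤ ·) (by omega)]
  have : E.filter (0 ≤ ·) = D.map Nat.castEmbedding := by
    ext k
    simp only [Finset.mem_filter, Finset.mem_map, Nat.castEmbedding_apply]
    constructor
    · rintro ⟨h1, h2⟩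
      lift k to ℕ using h2
      refine ⟨k, (h.2 k).1 ?_, rfl⟩
      have := hE k
      have : ¬ (k : ℤ) < 0 := by omega
      tauto
    · rintro ⟨d, hd, rfl⟩
      have := hE d
      have := (h.2 d).2 hd
      have : ¬ (d : ℤ) < 0 := by omega
      exact ⟨by tauto, by omega⟩
  rw [this, Finset.sum_map]
  exact Finset.sum_congr rfl fun d _ => if_pos (Int.natCast_nonneg d)

theorem IsDiagonal.card_eq {μ : YoungDiagram} {D : Finset ℕ} (h : IsDiagonal μ D) :
    μ.card = ∑ d ∈ D, (2 * d + 1) := by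
  have := h.sum_cells_eq (fun k => k)
  rw [← card_eq_sum] at this
  zify
  rw [this]
  refine Finset.sum_congr rfl fun d _ => by ring

theorem IsDiagonal.bgRank_eq {μ : YoungDiagram} {D : Finset ℕ} (h : IsDiagonal μ D) :
    bgRank μ = ∑ d ∈ D, if Even d then 1 else -1 := by
  rw [bgRank_eq_sum, h.sum_cells_eq fun k => if Even k then (1 : ℤ) else 0]
  refine Finset.sum_congr rfl fun d _ => ?_
  by_cases hd : Even d <;> simp [hd, parity_simps]

end DiagonalHooks

section Monomials

variable {R : Type*} [CommRing R]

theorem hasSubst_C_mul_X_pow (a : R) {k : ℕ} (hk : 0 < k) : HasSubst (C a * X ^ k : R⟦X⟧) :=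
  HasSubst.of_constantCoeff_zero' (by simp [hk.ne'])

theorem coeff_subst_C_mul_X_pow (a : R) {k : ℕ} (hk : 0 < k) (f : R⟦X⟧) (n : ℕ) :
    coeff n (f.subst (C a * X ^ k : R⟦X⟧)) =
      if k ∣ n then coeff (n / k) f * a ^ (n / k) else 0 := by
  have hterm : ∀ d, coeff d f • coeff n ((C a * X ^ k : R⟦X⟧) ^ d) =
      if n = k * d then coeff d f * a ^ d else 0 := by
    intro d
    rw [mul_pow, ← map_pow, ← pow_mul, coeff_C_mul, coeff_X_pow, smul_eq_mul]
    split_ifs <;> simp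
  rw [coeff_subst' (hasSubst_C_mul_X_pow a hk)]
  simp_rw [hterm]
  split_ifs with h
  · rw [finsum_eq_single _ (n / k), if_pos (Nat.mul_div_cancel' h).symm]
    intro d hd
    refine if_neg fun hc => hd ?_
    rw [hc, Nat.mul_div_cancel_left d hk]
  · refine finsum_eq_zero_of_forall_eq_zero fun d => if_neg fun hc => h ⟨d, hc⟩

theorem subst_monomial (a : R) {k : ℕ} (hk : 0 < k) (d : ℕ) (w : R) :
    (monomial d w).subst (C a * X ^ k : R⟦X⟧) = monomial (k * d) (w * a ^ d) := by
  ext n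
  rw [coeff_subst_C_mul_X_pow a hk, coeff_monomial, coeff_monomial]
  by_cases h : k ∣ n
  · obtain ⟨e, rfl⟩ := h
    rw [if_pos (Dvd.intro _ rfl), Nat.mul_div_cancel_left e hk]
    by_cases he : e = d
    · rw [he, if_pos rfl, if_pos rfl]
    · rw [if_neg he, if_neg fun h => he (Nat.eq_of_mul_eq_mul_left hk h), zero_mul]
  · rw [if_neg h, if_neg fun hc => h ⟨d, hc⟩]

theorem monomial_eq_C_mul_X_pow (n : ℕ) (a : R) : monomial n a = C a * X ^ n := by
  ext k
  rw [coeff_monomial, coeff_C_mul_X_pow]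

variable [TopologicalSpace R]

theorem summable_monomial {α : Type*} {s : α → ℕ} (hs : ∀ n, {a | s a = n}.Finite) (w : α → R) :
    Summable fun a => monomial (s a) (w a) := by
  refine (WithPiTopology.summable_iff_summable_coeff R).2 fun n => ?_
  refine summable_of_hasFiniteSupport ((hs n).subset fun a ha => ?_)
  by_contra hc
  refine ha ?_
  dsimp only
  rw [coeff_monomial, if_neg fun h => hc h.symm]

theorem hasSum_partitionSeries (S : Set YoungDiagram) (w : YoungDiagram → R) :
    HasSum (fun μ : S => monomial μ.1.card (w μ)) (partitionSeries S w) := by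
  classical
  refine (WithPiTopology.hasSum_iff_hasSum_coeff R).2 fun n => ?_
  change HasSum ((fun μ : YoungDiagram => coeff n (monomial μ.card (w μ))) ∘ Subtype.val) _
  rw [hasSum_subtype_iff_indicator, partitionSeries, coeff_mk]
  have h : ∑ μ ∈ partitionsOf n with μ ∈ S, w μ = ∑ μ ∈ partitionsOf n,
      S.indicator (fun μ : YoungDiagram => coeff n (monomial μ.card (w μ))) μ := by
    rw [Finset.sum_filter]
    refine Finset.sum_congr rfl fun μ hμ => ?_
    rw [Set.indicator_apply, coeff_monomial, if_pos (mem_partitionsOf.1 hμ).symm]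
  have hsum := hasSum_sum_of_ne_finset_zero (L := .unconditional _) (s := partitionsOf n)
    (f := S.indicator fun μ : YoungDiagram => coeff n (monomial μ.card (w μ))) fun μ hμ =>
      Set.indicator_apply_eq_zero.2 fun _ => by
        rw [coeff_monomial, if_neg fun h => hμ (mem_partitionsOf.2 h.symm)]
  rw [← h] at hsum
  convert hsum

theorem hasSum_partitionSeries_univ (w : YoungDiagram → R) :
    HasSum (fun μ => monomial μ.card (w μ)) (partitionSeries Set.univ w) :=
  (Equiv.Set.univ YoungDiagram).symm.hasSum_iff.2 (hasSum_partitionSeries Set.univ w)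

theorem finite_sum_fibers {α : Type*} {s : α → ℕ} (hs : ∀ n, {a | s a = n}.Finite) (m n : ℕ) :
    {a : Fin m → α | ∑ c, s (a c) = n}.Finite := by
  have hle : {a | s a ≤ n}.Finite := by
    refine ((Finset.range (n + 1)).finite_toSet.biUnion fun k _ => hs k).subset fun a ha => ?_
    simp only [Set.mem_iUnion]
    exact ⟨s a, Finset.mem_coe.2 (Finset.mem_range.2 (Nat.lt_succ_of_le ha)), rfl⟩
  refine (Set.Finite.pi' fun _ : Fin m => hle).subset fun a ha c => ?_
  change s (a c) ≤ n
  rw [← show ∑ c, s (a c) = n from ha]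
  exact Finset.single_le_sum (f := fun c => s (a c)) (fun _ _ => Nat.zero_le _)
    (Finset.mem_univ c)

variable [DiscreteTopology R]

theorem hasSum_prod_monomial {α : Type*} {s : α → ℕ} (hs : ∀ n, {a | s a = n}.Finite) {m : ℕ}
    (w : Fin m → α → R) (F : Fin m → R⟦X⟧)
    (hF : ∀ c, HasSum (fun a => monomial (s a) (w c a)) (F c)) :
    HasSum (fun a : Fin m → α => monomial (∑ c, s (a c)) (∏ c, w c (a c))) (∏ c, F c) := by
  induction m with
  | zero =>
    simp
  | succ m ih =>
    let e : α × (Fin m → α) ≃ (Fin (m + 1) → α) := Fin.consEquiv fun _ => α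
    let f : (Fin (m + 1) → α) → R⟦X⟧ := fun a => monomial (∑ c, s (a c)) (∏ c, w c (a c))
    have hterm : (fun p : α × (Fin m → α) => monomial (s p.1) (w 0 p.1) *
        monomial (∑ c, s (p.2 c)) (∏ c, w (Fin.succ c) (p.2 c))) = f ∘ e := by
      funext p
      rw [monomial_mul_monomial]
      simp [f, e, Fin.consEquiv, Fin.sum_univ_succ, Fin.prod_univ_succ]
    have hsum : Summable f :=
      summable_monomial (finite_sum_fibers hs (m + 1)) fun a => ∏ c, w c (a c)
    have h := (hF 0).mul (ih (fun c => w c.succ) (fun c => F c.succ) fun c => hF c.succ)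
      (hterm ▸ e.summable_iff.2 hsum)
    rw [hterm] at h
    rw [Fin.prod_univ_succ]
    exact e.hasSum_iff.1 h

theorem continuous_subst (a : R) {k : ℕ} (hk : 0 < k) :
    Continuous fun f : R⟦X⟧ => f.subst (C a * X ^ k : R⟦X⟧) := by
  rw [continuous_iff_continuousAt]
  intro f
  refine (WithPiTopology.tendsto_iff_coeff_tendsto (R := R) _ _ _).2 fun n => ?_
  simp_rw [coeff_subst_C_mul_X_pow a hk]
  split_ifs
  · exact ((WithPiTopology.continuous_coeff R _).tendsto f).mul_const _
  · exact tendsto_const_nhds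

theorem hasSum_subst (a : R) {k : ℕ} (hk : 0 < k) (w : YoungDiagram → R) :
    HasSum (fun μ => monomial (k * μ.card) (w μ * a ^ μ.card))
      ((partitionSeries Set.univ w).subst (C a * X ^ k : R⟦X⟧)) := by
  have h := (hasSum_partitionSeries_univ w).map (substAlgHom (hasSubst_C_mul_X_pow a hk))
    (by rw [coe_substAlgHom]; exact continuous_subst a hk)
  rw [coe_substAlgHom] at h
  convert h using 1
  funext μ
  exact (subst_monomial a hk _ _).symm

end Monomials

section Products

theorem sum_rowLens (μ : YoungDiagram) : μ.rowLens.sum = μ.card := by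
  have h := sum_cells_eq μ (fun _ _ => (1 : ℤ)) le_rfl
  simp only [Finset.sum_const, Finset.card_range, nsmul_eq_mul, mul_one] at h
  have h2 : μ.rowLens.sum = ∑ i ∈ Finset.range (μ.colLen 0), μ.rowLen i := rfl
  rw [h2]
  exact_mod_cast h.symm

theorem card_partitionsOf (n : ℕ) : (partitionsOf n).card = Fintype.card n.Partition := by
  refine Finset.card_bij (t := Finset.univ)
    (fun μ hμ => ⟨μ.rowLens, fun {i} hi => μ.pos_of_mem_rowLens i hi, ?_⟩) ?_ ?_ ?_
  · rw [Multiset.sum_coe, sum_rowLens, mem_partitionsOf.1 hμ]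
  · simp
  · intro μ hμ ν hν h
    rw [Nat.Partition.mk.injEq, Multiset.coe_eq_coe] at h
    refine YoungDiagram.equivListRowLens.injective (Subtype.ext ?_)
    exact h.eq_of_sortedGE μ.rowLens_sorted ν.rowLens_sorted
  · intro p _
    have hpos : ∀ x ∈ p.parts.sort (· ≥ ·), 0 < x := fun x hx =>
      p.parts_pos ((Multiset.mem_sort _).1 hx)
    have hrow := YoungDiagram.rowLens_ofRowLens_eq_self
      (hw := (Multiset.pairwise_sort p.parts (· ≥ ·)).sortedGE) hpos
    refine ⟨YoungDiagram.ofRowLens _ (Multiset.pairwise_sort p.parts (· ≥ ·)).sortedGE, ?_, ?_⟩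
    · rw [mem_partitionsOf, ← sum_rowLens, hrow, ← Multiset.sum_coe, Multiset.sort_eq, p.parts_sum]
    · ext1
      dsimp only
      rw [hrow, Multiset.sort_eq]

variable {R : Type*} [CommRing R] [TopologicalSpace R] [DiscreteTopology R]

theorem hasProd_qPoch (a p : R⟦X⟧) (hp : constantCoeff p = 0) :
    HasProd (fun j : ℕ => 1 - a * p ^ j) (qPoch a p) := by
  obtain rfl : ‹TopologicalSpace R› = ⊥ := DiscreteTopology.eq_bot
  let : TopologicalSpace R := ⊥
  exact (multipliable_qPoch a p hp).hasProd

theorem partitionSeries_one_mul_qPoch :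
    partitionSeries Set.univ (fun _ => (1 : R)) * qPoch X X = 1 := by
  have hgen : partitionSeries Set.univ (fun _ => (1 : R)) =
      Nat.Partition.genFun fun _ _ => (1 : R) := by
    ext n
    simp [partitionSeries, Finsupp.prod, card_partitionsOf]
  rw [hgen]
  refine ((Nat.Partition.hasProd_genFun (fun _ _ => (1 : R))).mul
    (hasProd_qPoch X X constantCoeff_X)).unique ?_
  convert hasProd_one with i
  have hc : constantCoeff (X ^ (i + 1) : R⟦X⟧) = 0 := by simp
  have h := WithPiTopology.tsum_pow_mul_one_sub_of_constantCoeff_eq_zero hc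
  rw [(WithPiTopology.summable_pow_of_constantCoeff_eq_zero hc).tsum_eq_zero_add] at h
  simp only [pow_zero, ← pow_mul] at h
  simpa only [← pow_succ', one_smul] using h

theorem subst_partitionSeries_one_mul_qPoch {k : ℕ} (hk : 0 < k) :
    (partitionSeries Set.univ fun _ => (1 : R)).subst (C 1 * X ^ k : R⟦X⟧) *
      qPoch (X ^ k) (X ^ k) = 1 := by
  have hs := hasSubst_C_mul_X_pow (1 : R) hk
  obtain ⟨φ, hφ⟩ : ∃ φ : R⟦X⟧ →ₐ[R] R⟦X⟧, ⇑φ = fun f => f.subst (C 1 * X ^ k : R⟦X⟧) :=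
    ⟨substAlgHom hs, coe_substAlgHom hs⟩
  have hX : φ (X : R⟦X⟧) = X ^ k := by
    rw [hφ]
    dsimp only
    rw [subst_X hs, map_one, one_mul]
  have hcont : Continuous φ := hφ ▸ continuous_subst 1 hk
  have h := (hasProd_qPoch (X : R⟦X⟧) X constantCoeff_X).map φ hcont
  have h2 : φ (qPoch X X) = qPoch (X ^ k) (X ^ k) := by
    refine h.unique ?_
    refine (hasProd_qPoch (X ^ k : R⟦X⟧) (X ^ k : R⟦X⟧) (by simp [hk.ne'])).congr_fun fun j => ?_
    rw [Function.comp_apply, map_sub, map_mul, map_pow, map_one, hX]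
  have h3 : φ (partitionSeries Set.univ fun _ => (1 : R)) =
      (partitionSeries Set.univ fun _ => (1 : R)).subst (C 1 * X ^ k : R⟦X⟧) := by rw [hφ]
  rw [← h2, ← h3, ← map_mul, partitionSeries_one_mul_qPoch, map_one]

end Products

section SelfConjugate

variable {R : Type*} [CommRing R] [TopologicalSpace R] [DiscreteTopology R]

theorem partitionSeries_SC_eq (b : Rˣ) :
    partitionSeries SC (fun μ => ((b ^ bgRank μ : Rˣ) : R)) =
      qPoch (-(C (b : R) * X)) (X ^ 4) * qPoch (-(C ((b⁻¹ : Rˣ) : R) * X ^ 3)) (X ^ 4) := by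
  let w : ℕ → R := fun d => ((b ^ (if Even d then 1 else -1 : ℤ) : Rˣ) : R)
  have hterm : ∀ μ : SC, (monomial μ.1.card ((b ^ bgRank μ.1 : Rˣ) : R) : R⟦X⟧) =
      ∏ d ∈ diagonalEquiv μ, monomial (2 * d + 1) (w d) := by
    intro μ
    have h := isDiagonal_diagonalEquiv μ
    rw [prod_monomial, h.card_eq, h.bgRank_eq]
    congr 1
    have : ∀ D : Finset ℕ, b ^ (∑ d ∈ D, if Even d then 1 else -1 : ℤ) =
        ∏ d ∈ D, b ^ (if Even d then 1 else -1 : ℤ) := by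
      intro D
      induction D using Finset.induction_on with
      | empty => simp
      | insert d D hd ih => rw [Finset.sum_insert hd, Finset.prod_insert hd, zpow_add, ih]
    rw [this, Units.coe_prod]
  have h := hasSum_partitionSeries SC fun μ => ((b ^ bgRank μ : Rˣ) : R)
  simp_rw [hterm] at h
  have h2 := hasProd_one_add_of_hasSum_prod (diagonalEquiv.hasSum_iff.1 h)
  refine h2.unique (HasProd.even_mul_odd ?_ ?_)
  · refine (hasProd_qPoch (-(C (b : R) * X)) (X ^ 4) (by simp)).congr_fun fun j => ?_
    rw [show w (2 * j) = b by simp [w], monomial_eq_C_mul_X_pow]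
    ring
  · refine (hasProd_qPoch (-(C ((b⁻¹ : Rˣ) : R) * X ^ 3)) (X ^ 4) (by simp)).congr_fun fun j => ?_
    rw [show w (2 * j + 1) = (b⁻¹ : Rˣ) by simp [w], monomial_eq_C_mul_X_pow]
    ring

variable {m : ℕ}

/-- The generating function of the cores of the self-conjugate partitions. -/
noncomputable def coreSeries (hm : 0 < m) (b : Rˣ) : R⟦X⟧ :=
  ∑' n : Fin m → ℤ, monomial ((quotientEquiv hm).symm fun c => (n c, ⊥)).1.card
    ((b ^ bgRank ((quotientEquiv hm).symm fun c => (n c, ⊥)).1 : Rˣ) : R)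

theorem hasSum_SC (hm : 0 < m) (b : Rˣ) (w : (Fin m → YoungDiagram) → R) {F : R⟦X⟧}
    (hF : HasSum (fun ν => monomial (∑ c, 4 * m * (ν c).card) (w ν)) F) :
    HasSum (fun μ : SC => monomial μ.1.card
      (((b ^ bgRank μ.1 : Rˣ) : R) * w fun c => (quotientEquiv hm μ c).2))
      (coreSeries hm b * F) := by
  have hfin : ∀ n, {μ : SC | μ.1.card = n}.Finite := fun n =>
    (finite_card_eq n).preimage Subtype.val_injective.injOn
  have hcore := (summable_monomial (s := fun n : Fin m → ℤ =>
    ((quotientEquiv hm).symm fun c => (n c, ⊥)).1.card) (fun n => (hfin n).preimage fun a _ a' _ h => by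
      have := (quotientEquiv hm).symm.injective h
      funext c
      exact congrArg Prod.fst (congrFun this c)) fun n : Fin m → ℤ =>
    ((b ^ bgRank ((quotientEquiv hm).symm fun c => (n c, ⊥)).1 : Rˣ) : R)).hasSum
  let e : SC ≃ (Fin m → ℤ) × (Fin m → YoungDiagram) :=
    (quotientEquiv hm).trans (Equiv.arrowProdEquivProdArrow _ _ _)
  have hterm : ∀ μ : SC, monomial μ.1.card
      (((b ^ bgRank μ.1 : Rˣ) : R) * w fun c => (quotientEquiv hm μ c).2) =
      monomial ((quotientEquiv hm).symm fun c => ((e μ).1 c, ⊥)).1.card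
        ((b ^ bgRank ((quotientEquiv hm).symm fun c => ((e μ).1 c, ⊥)).1 : Rˣ) : R) *
      monomial (∑ c, 4 * m * ((e μ).2 c).card) (w (e μ).2) := by
    intro μ
    have h := isQuotient_quotientEquiv hm μ
    have h0 := isQuotient_quotientEquiv hm ((quotientEquiv hm).symm fun c => ((e μ).1 c, ⊥))
    rw [Equiv.apply_symm_apply] at h0
    rw [monomial_mul_monomial, h.card_eq hm h0, h.bgRank_eq hm h0, Finset.mul_sum]
    rfl
  have hsum := summable_monomial hfin fun μ : SC =>
    ((b ^ bgRank μ.1 : Rˣ) : R) * w fun c => (quotientEquiv hm μ c).2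
  simp_rw [hterm] at hsum ⊢
  exact e.hasSum_iff.2 (hcore.mul hF (e.summable_iff.1 hsum))

end SelfConjugate

section Weighted

theorem IsQuotient.weight_eq {R : Type*} [CommRing R] {m : ℕ} (hm : 0 < m)
    {μ : YoungDiagram} {q : Fin m → ℤ × YoungDiagram}
    (h : IsQuotient μ q) (ρ₁ ρ₂ : ℤ × ℤˣ → R) (x : R) :
    x ^ (boxes (2 * m) μ).card * (∏ u ∈ boxes (2 * m) μ, ρ₁ (hookLength μ u, boxSign u)) *
        ∑ u ∈ boxes (2 * m) μ, ρ₂ (hookLength μ u, boxSign u) =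
      (∏ c, (∏ u ∈ (q c).2.cells, ρ₁ ((2 * m : ℕ) * hookLength (q c).2 u, 1) *
          ρ₁ ((2 * m : ℕ) * hookLength (q c).2 u, -1)) * (x ^ 2) ^ (q c).2.card) *
        ∑ c, ∑ u ∈ (q c).2.cells, (ρ₂ ((2 * m : ℕ) * hookLength (q c).2 u, 1) +
          ρ₂ ((2 * m : ℕ) * hookLength (q c).2 u, -1)) := by
  rw [h.sum_boxes hm, ← Finset.prod_const, ← Finset.prod_mul_distrib,
    h.prod_boxes hm fun p => x * ρ₁ p]
  congr 1
  refine Finset.prod_congr rfl fun c _ => ?_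
  rw [YoungDiagram.card, ← Finset.prod_const, ← Finset.prod_mul_distrib]
  exact Finset.prod_congr rfl fun u _ => by ring

variable {R : Type*} [CommRing R] [TopologicalSpace R] [DiscreteTopology R] {m : ℕ}

theorem finite_mul_card_fibers (hm : 0 < m) (n : ℕ) :
    {ν : YoungDiagram | 4 * m * ν.card = n}.Finite := by
  refine (finite_card_eq (n / (4 * m))).subset fun ν hν => ?_
  rw [Set.mem_ofPred_eq] at hν ⊢
  rw [← hν, Nat.mul_div_cancel_left _ (by omega)]

theorem hasSum_prod_mul_sum (hm : 0 < m) (v σ : YoungDiagram → R) {F G : R⟦X⟧}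
    (hF : HasSum (fun ν => monomial (4 * m * ν.card) (v ν)) F)
    (hG : HasSum (fun ν => monomial (4 * m * ν.card) (v ν * σ ν)) G) :
    HasSum (fun ν : Fin m → YoungDiagram => monomial (∑ c, 4 * m * (ν c).card)
      ((∏ c, v (ν c)) * ∑ c, σ (ν c))) ((m : R⟦X⟧) * F ^ (m - 1) * G) := by
  have h : ∀ c₀ : Fin m, HasSum (fun ν : Fin m → YoungDiagram =>
      monomial (∑ c, 4 * m * (ν c).card) ((∏ c, v (ν c)) * σ (ν c₀))) (F ^ (m - 1) * G) := by
    intro c₀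
    have key : ∀ {S : Type _} [CommRing S] (f g : Fin m → S),
        ∏ c, (if c = c₀ then f c * g c else f c) = (∏ c, f c) * g c₀ := by
      intro S _ f g
      rw [← Finset.prod_ite_eq' Finset.univ c₀ g |>.trans (if_pos (Finset.mem_univ c₀)),
        ← Finset.prod_mul_distrib]
      refine Finset.prod_congr rfl fun c _ => ?_
      split_ifs <;> simp
    have h1 := hasSum_prod_monomial (finite_mul_card_fibers hm)
      (fun c ν => if c = c₀ then v ν * σ ν else v ν) (fun c => if c = c₀ then G else F) (by
        intro c
        by_cases hc : c = c₀
        · simpa only [if_pos hc] using hG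
        · simpa only [if_neg hc] using hF)
    have h2 : ∏ c, (if c = c₀ then G else F) = F ^ (m - 1) * G := by
      rw [← Finset.mul_prod_erase _ _ (Finset.mem_univ c₀), if_pos rfl, mul_comm]
      congr 1
      rw [Finset.prod_congr rfl fun c hc => if_neg (Finset.ne_of_mem_erase hc), Finset.prod_const,
        Finset.card_erase_of_mem (Finset.mem_univ _), Finset.card_univ, Fintype.card_fin]
    rw [h2] at h1
    refine h1.congr_fun fun ν => ?_
    rw [key (fun c => v (ν c)) fun c => σ (ν c)]
  have hsum := hasSum_sum (s := Finset.univ) fun c₀ _ => h c₀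
  rw [Finset.sum_const, Finset.card_univ, Fintype.card_fin, nsmul_eq_mul, ← mul_assoc] at hsum
  refine hsum.congr_fun fun ν => ?_
  rw [Finset.mul_sum, map_sum]

theorem coreSeries_eq (hm : 0 < m) (b : Rˣ) :
    coreSeries hm b = qPoch (X ^ (4 * m)) (X ^ (4 * m)) ^ m *
      (qPoch (-(C (b : R) * X)) (X ^ 4) * qPoch (-(C ((b⁻¹ : Rˣ) : R) * X ^ 3)) (X ^ 4)) := by
  have hk : 0 < 4 * m := by omega
  have hP := hasSum_subst (1 : R) hk fun _ => (1 : R)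
  simp only [one_pow, mul_one] at hP
  have h1 := hasSum_prod_monomial (finite_mul_card_fibers hm)
    (fun (_ : Fin m) (_ : YoungDiagram) => (1 : R)) _ fun _ => hP
  have h2 := hasSum_SC hm b _ h1
  simp only [Finset.prod_const_one, mul_one] at h2
  have h3 := h2.unique (hasSum_partitionSeries SC fun μ => ((b ^ bgRank μ : Rˣ) : R))
  rw [← partitionSeries_SC_eq, ← h3, Finset.prod_const, Finset.card_univ, Fintype.card_fin,
    mul_left_comm, ← mul_pow, mul_comm (qPoch _ _), subst_partitionSeries_one_mul_qPoch hk,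
    one_pow, mul_one]

end Weighted

end SelfConjHook

/-- An identity of formal power series in `q = X` over an arbitrary commutative ring `R`, for any
element `x` and any unit `b` of `R`; taking `R` to be a ring of Laurent polynomials, `x` and `b`
may be indeterminates. -/
theorem theorem5p2 {R : Type*} [CommRing R] (t : ℕ) (ht : Even t) (ht0 : 0 < t)
    (ρ₁ ρ₂ : ℤ × ℤˣ → R) (x : R) (b : Rˣ) :
    partitionSeries SC (fun μ =>
        x ^ (boxes t μ).card * ((b ^ bgRank μ : Rˣ) : R) *
          (∏ u ∈ boxes t μ,
            ρ₁ (hookLength μ u, boxSign u)) *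
          ∑ u ∈ boxes t μ,
            ρ₂ (hookLength μ u, boxSign u)) =
      ((t / 2 : ℕ) : R⟦X⟧) *
        (fSeries t ρ₁).subst
            (C (x ^ 2) * X ^ (2 * t) : R⟦X⟧) ^ (t / 2 - 1) *
        (gSeries t ρ₁ ρ₂).subst
            (C (x ^ 2) * X ^ (2 * t) : R⟦X⟧) *
        qPoch (X ^ (2 * t)) (X ^ (2 * t)) ^ (t / 2) *
        qPoch (-(C (b : R) * X)) (X ^ 4) *
        qPoch (-(C ((b⁻¹ : Rˣ) : R) * X ^ 3))
          (X ^ 4) := by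
  obtain ⟨m, rfl⟩ := even_iff_exists_two_mul.1 ht
  have hm : 0 < m := by omega
  have hk : 0 < 4 * m := by omega
  let : TopologicalSpace R := ⊥
  have : DiscreteTopology R := ⟨rfl⟩
  rw [Nat.mul_div_cancel_left m two_pos, ← mul_assoc 2 2 m]
  norm_num only
  let v : YoungDiagram → R := fun ν => (∏ u ∈ ν.cells, ρ₁ ((2 * m : ℕ) * hookLength ν u, 1) *
    ρ₁ ((2 * m : ℕ) * hookLength ν u, -1)) * (x ^ 2) ^ ν.card
  let σ : YoungDiagram → R := fun ν => ∑ u ∈ ν.cells,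
    (ρ₂ ((2 * m : ℕ) * hookLength ν u, 1) + ρ₂ ((2 * m : ℕ) * hookLength ν u, -1))
  have hF : HasSum (fun ν => monomial (4 * m * ν.card) (v ν)) _ := hasSum_subst (x ^ 2) hk
    fun ν => ∏ u ∈ ν.cells, ρ₁ ((2 * m : ℕ) * hookLength ν u, 1) *
      ρ₁ ((2 * m : ℕ) * hookLength ν u, -1)
  have hG : HasSum (fun ν => monomial (4 * m * ν.card) (v ν * σ ν)) _ :=
    (hasSum_subst (x ^ 2) hk fun ν => (∏ u ∈ ν.cells, ρ₁ ((2 * m : ℕ) * hookLength ν u, 1) *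
      ρ₁ ((2 * m : ℕ) * hookLength ν u, -1)) * σ ν).congr_fun fun ν => by
        rw [mul_right_comm (∏ u ∈ ν.cells, _) (σ ν)]
  have h := hasSum_SC hm b _ (hasSum_prod_mul_sum hm v σ hF hG)
  refine ((hasSum_partitionSeries SC _).unique (h.congr_fun fun μ => ?_)).trans ?_
  · congr 1
    rw [← (isQuotient_quotientEquiv hm μ).weight_eq hm ρ₁ ρ₂ x]
    ring
  · rw [coreSeries_eq]
    change _ * ((m : R⟦X⟧) * (fSeries (2 * m) ρ₁).subst _ ^ (m - 1) *
      (gSeries (2 * m) ρ₁ ρ₂).subst _) = _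
    ring
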